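/- A spherical curve is a closed curve on $S^2$ whose self-intersections (crossings) are transverse double points, up to ambient isotopy and reflection; it is reducible if some circle on $S^2$ meets it transversely at just one crossing and nowhere else. An inverse-half-twisted splice is a splice at a crossing which again yields one closed curve; the reductivity of a nontrivial spherical curve is the minimal number of inverse-half-twisted splices needed to obtain a reducible spherical curve. An $n$-gon is a complementary region with $n$ sides. Name the sides of a 4-gon $a,b,c,d$ and those of a 5-gon $a,b,c,d,e$ in cyclic order around it (in either rotational direction), orient the curve so that $a$ is passed in the direction of this labelling, and read off the cyclic word in which the curve passes the sides (the outer connections). A 3-gon is of type D if its three sides are coherently oriented around it and the curve passes them in the cyclic order in which they follow each other along that orientation. A 5-gon is of type 2 if exactly the side $e$, and of type 4 if exactly the sides $c$ and $e$, are passed against the direction of the labelling. Theorem. Every spherical curve of reductivity four contains at least one member of the following set $U_3$ of configurations, each consisting of a 3-gon of type D and a 4-gon or 5-gon that share the indicated side: (i) a 4-gon, sharing the side $d$, in which either only $d$ is passed against the labelling and the cyclic word is $abdc$, or exactly $b$ and $d$ are passed against the labelling and the cyclic word is $adcb$; (ii) a 5-gon of type 2, sharing the side $e$, with cyclic word $abced$,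 $abecd$, $abedc$, $acbed$, $acebd$, $acedb$, $aedbc$ or $aedcb$; (iii) a 5-gon of type 4, sharing the side $e$, with cyclic word $abced$, $abedc$, $acbed$, $acebd$, $acedb$, $aecbd$ or $aedcb$; (iv) a 5-gon of type 4, sharing the side $d$, with cyclic word $abcde$, $abdec$, $acbde$, $acdbe$, $acdeb$, $adbec$, $adecb$ or $aecbd$; (v) a 5-gon of type 4, sharing the side $c$, with cyclic word $abdec$, $abedc$, $acbde$, $acbed$, $acebd$, $adcbe$, $adecb$, $aecbd$ or $aedcb$. -/

import Mathlib

/-- The number of cycles of a permutation, fixed points counted as cycles. -/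
noncomputable def numCycles {X : Type} (f : Equiv.Perm X) : ℕ :=
  Nat.card (Quotient (Equiv.Perm.SameCycle.setoid f))

/-- A nontrivial spherical curve (up to ambient isotopy of the sphere), given by its combinatorial
map. A dart is a half-edge pointing away from a crossing. `opp` sends a dart to the other half of
its edge, and `rot` sends a dart to the next one counterclockwise around the same crossing. Each
crossing is a transverse double point, i.e. it has exactly four darts, and the branch through a
dart `d` continues in `rot (rot d)`. The map has genus zero (Euler's formula), and following the
curve straight ahead from any dart one passes along every edge (one single closed curve). -/
structure SphericalCurve where
  /-- the half-edges -/
  Dart : Type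
  finite : Finite Dart
  /-- the other half of the edge -/
  opp : Equiv.Perm Dart
  /-- the counterclockwise rotation around the crossings -/
  rot : Equiv.Perm Dart
  opp_opp : ∀ d, opp (opp d) = d
  opp_ne : ∀ d, opp d ≠ d
  rot_four : ∀ d, rot (rot (rot (rot d))) = d
  rot_two_ne : ∀ d, rot (rot d) ≠ d
  single : ∀ x y : Dart, ∃ k : ℕ,
    (fun d => rot (rot (opp d)))^[k] x = y ∨ (fun d => rot (rot (opp d)))^[k] x = opp y
  euler : numCycles rot + numCycles (opp.trans rot.symm) = numCycles opp + 2

namespace SphericalCurve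

/-- Walking straight ahead along the curve: from the half-edge `d`, run along its edge to the other
end and leave the crossing there by the opposite half-edge. -/
def ahead (P : SphericalCurve) (d : P.Dart) : P.Dart := P.rot (P.rot (P.opp d))

/-- The face permutation: run along the edge of `d` and take the next edge of the boundary of the
face on the left of `d`. Its cycles are the faces (the components of the complement of the curve),
each of them traversed counterclockwise. -/
def face (P : SphericalCurve) : Equiv.Perm P.Dart := P.opp.trans P.rot.symm

/-- The mirror image of a spherical curve. -/
def IsMirror (P Q : SphericalCurve) : Prop :=
  ∃ e : Q.Dart ≃ P.Dart, (∀ x, e (Q.opp x) = P.opp (e x)) ∧ (∀ x, e (Q.rot x) = P.rot.symm (e x))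

/-- Some circle meets the curve transversely in just one crossing: the circle leaves the crossing
through two opposite corners, which therefore lie in the same face. The corner between `d` and
`rot d` lies in the face on the left of `d`. -/
def Reducible (P : SphericalCurve) : Prop :=
  ∃ d : P.Dart, P.face.SameCycle d (P.rot (P.rot d))

/-- The dart `x` belongs to the crossing of the dart `c`. -/
def AtCrossing (P : SphericalCurve) (c x : P.Dart) : Prop := P.rot.SameCycle c x

open Classical in
/-- How to continue at a crossing after the splice at the crossing of `c` which joins the branch
end `c` to `rot c` and the branch end `rot (rot c)` to `rot (rot (rot c))`: at all other
crossings one goes straight. (The other splice at that crossing is the one named by `rot c`.) -/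
noncomputable def spliceTurn (P : SphericalCurve) (c x : P.Dart) : P.Dart :=
  if x = c then P.rot c
  else if x = P.rot c then c
  else if x = P.rot (P.rot c) then P.rot (P.rot (P.rot c))
  else if x = P.rot (P.rot (P.rot c)) then P.rot (P.rot c)
  else P.rot (P.rot x)

/-- `Q` is obtained from `P` by an inverse-half-twisted splice: by a splice at a crossing that
again yields one single closed curve (first clause: after the splice, the edges of `P` are still
passed in one single tour). The crossing of `c` disappears and the edges meeting there are
concatenated along the splice (last clause). -/
def HalfTwistedSplice (P Q : SphericalCurve) : Prop :=
  ∃ c : P.Dart,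
    (∀ x y : P.Dart, ∃ k : ℕ,
      (fun d => P.spliceTurn c (P.opp d))^[k] x = y ∨
      (fun d => P.spliceTurn c (P.opp d))^[k] x = P.opp y) ∧
    ∃ e : Q.Dart ≃ {x : P.Dart // ¬ P.AtCrossing c x},
      (∀ x, (e (Q.rot x) : P.Dart) = P.rot (e x)) ∧
      (∀ x, ∃ k : ℕ,
        (e (Q.opp x) : P.Dart) = (fun d => P.opp (P.spliceTurn c d))^[k] (P.opp (e x)) ∧
        ∀ j < k, P.AtCrossing c ((fun d => P.opp (P.spliceTurn c d))^[j] (P.opp (e x))))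

/-- `Q` is obtained from `P` by `k` successive inverse-half-twisted splices. -/
inductive SpliceSteps : ℕ → SphericalCurve → SphericalCurve → Prop
  | refl (P : SphericalCurve) : SpliceSteps 0 P P
  | step {k : ℕ} {P Q R : SphericalCurve} :
      HalfTwistedSplice P Q → SpliceSteps k Q R → SpliceSteps (k + 1) P R

/-- The reductivity: the minimal number of inverse-half-twisted splices required to obtain a
reducible spherical curve. (A trivial curve is not reducible and admits no splice, so only
nontrivial curves occur on the way.) -/
noncomputable def reductivity (P : SphericalCurve) : ℕ∞ :=
  ⨅ (k : ℕ) (_ : ∃ Q : SphericalCurve, SpliceSteps k P Q ∧ Q.Reducible), (k : ℕ∞)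

/-- The face on the left of `d` is an `n`-gon; its sides, counterclockwise and starting with the
side of `d`, carry the labels `0, …, n - 1`. -/
def IsGon (P : SphericalCurve) (n : ℕ) (d : P.Dart) : Prop :=
  Function.minimalPeriod P.face d = n

/-- The side with label `i`, as a dart running counterclockwise (`s = true`) or clockwise
(`s = false`) around the face. -/
def side (P : SphericalCurve) (d : P.Dart) (i : ℕ) (s : Bool) : P.Dart :=
  if s then P.face^[i] d else P.opp (P.face^[i] d)

/-- The outer connections of an `n`-gon: during one tour along the whole curve (for one of its two
orientations) the sides are passed in the cyclic order `seq 0, seq 1, …, seq (n - 1)`, where side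
`i` is passed counterclockwise around the face if `dir i = true` and clockwise otherwise. -/
def HasOuterConnections (P : SphericalCurve) {n : ℕ} (d : P.Dart)
    (dir : Fin n → Bool) (seq : Fin n → Fin n) : Prop :=
  ∃ (x : P.Dart) (t : Fin n → ℕ), StrictMono t ∧
    (∀ j, t j < Function.minimalPeriod P.ahead x) ∧
    ∀ j, P.ahead^[t j] x = P.side d (seq j : ℕ) (dir (seq j))

/-- The face on the left of `d` is a 3-gon of type D: its three sides are coherently oriented, and
the curve passes them in the cyclic order in which they follow each other, along that orientation,
on the boundary of the 3-gon. -/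
def IsTypeD (P : SphericalCurve) (d : P.Dart) : Prop :=
  P.IsGon 3 d ∧ P.HasOuterConnections d (fun _ : Fin 3 => true) id

end SphericalCurve

/-- A configuration with outer connections, consisting of a 3-gon of type D and an `n`-gon which
share a side: the orientations of the sides of the `n`-gon, the cyclic sequence in which the curve
passes them, and the label of the side shared with the 3-gon. -/
structure Configuration where
  /-- the number of sides -/
  n : ℕ
  /-- the orientations of the sides -/
  dir : Fin n → Bool
  /-- the cyclic sequence of the sides along the curve -/
  seq : Fin n → Fin n
  /-- the side shared with the 3-gon of type D -/
  shared : Fin n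

namespace SphericalCurve

/-- The configuration occurs in `P`, with the labels of the `n`-gon running counterclockwise. -/
def Occurs (P : SphericalCurve) (C : Configuration) : Prop :=
  ∃ d : P.Dart, P.IsGon C.n d ∧ P.HasOuterConnections d C.dir C.seq ∧
    P.IsTypeD (P.side d (C.shared : ℕ) false)

/-- The configuration occurs in `P`; mirror images are not distinguished. -/
def HasConfiguration (P : SphericalCurve) (C : Configuration) : Prop :=
  P.Occurs C ∨ ∃ Q : SphericalCurve, P.IsMirror Q ∧ Q.Occurs C

end SphericalCurve

namespace UnavoidableSet

/-- 4-gons with sides `a, b, c, d = 0, 1, 2, 3`: only `d` is oriented against the others. -/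
def oneOdd : Fin 4 → Bool := ![true, true, true, false]

/-- 4-gons whose sides are alternately oriented. -/
def alternating : Fin 4 → Bool := ![true, false, true, false]

/-- 5-gons of type 2, sides `a, b, c, d, e = 0, 1, 2, 3, 4`: only `e` is oriented against the
others. -/
def type2 : Fin 5 → Bool := ![true, true, true, true, false]

/-- 5-gons of type 4: the two non-adjacent sides `c` and `e` are oriented against the others. -/
def type4 : Fin 5 → Bool := ![true, true, false, true, false]

/-- The 4-gons sharing the side `d` with a 3-gon of type D. -/
def withFourGon : List Configuration :=
  [ -- abdc
    ⟨4, oneOdd, ![0, 1, 3, 2], 3⟩,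
    -- adcb
    ⟨4, alternating, ![0, 3, 2, 1], 3⟩ ]

/-- The 5-gons of type 2 sharing the side `e` with a 3-gon of type D. -/
def withType2e : List Configuration :=
  [ -- abced, abecd, abedc, acbed
    ⟨5, type2, ![0, 1, 2, 4, 3], 4⟩, ⟨5, type2, ![0, 1, 4, 2, 3], 4⟩,
    ⟨5, type2, ![0, 1, 4, 3, 2], 4⟩, ⟨5, type2, ![0, 2, 1, 4, 3], 4⟩,
    -- acebd, acedb, aedbc, aedcb
    ⟨5, type2, ![0, 2, 4, 1, 3], 4⟩, ⟨5, type2, ![0, 2, 4, 3, 1], 4⟩,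
    ⟨5, type2, ![0, 4, 3, 1, 2], 4⟩, ⟨5, type2, ![0, 4, 3, 2, 1], 4⟩ ]

/-- The 5-gons of type 4 sharing the side `e` with a 3-gon of type D. -/
def withType4e : List Configuration :=
  [ -- abced, abedc, acbed, acebd
    ⟨5, type4, ![0, 1, 2, 4, 3], 4⟩, ⟨5, type4, ![0, 1, 4, 3, 2], 4⟩,
    ⟨5, type4, ![0, 2, 1, 4, 3], 4⟩, ⟨5, type4, ![0, 2, 4, 1, 3], 4⟩,
    -- acedb, aecbd, aedcb
    ⟨5, type4, ![0, 2, 4, 3, 1], 4⟩, ⟨5, type4, ![0, 4, 2, 1, 3], 4⟩,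
    ⟨5, type4, ![0, 4, 3, 2, 1], 4⟩ ]

/-- The 5-gons of type 4 sharing the side `d` with a 3-gon of type D. -/
def withType4d : List Configuration :=
  [ -- abcde, abdec, acbde, acdbe
    ⟨5, type4, ![0, 1, 2, 3, 4], 3⟩, ⟨5, type4, ![0, 1, 3, 4, 2], 3⟩,
    ⟨5, type4, ![0, 2, 1, 3, 4], 3⟩, ⟨5, type4, ![0, 2, 3, 1, 4], 3⟩,
    -- acdeb, adbec, adecb, aecbd
    ⟨5, type4, ![0, 2, 3, 4, 1], 3⟩, ⟨5, type4, ![0, 3, 1, 4, 2], 3⟩,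
    ⟨5, type4, ![0, 3, 4, 2, 1], 3⟩, ⟨5, type4, ![0, 4, 2, 1, 3], 3⟩ ]

/-- The 5-gons of type 4 sharing the side `c` with a 3-gon of type D. -/
def withType4c : List Configuration :=
  [ -- abdec, abedc, acbde, acbed
    ⟨5, type4, ![0, 1, 3, 4, 2], 2⟩, ⟨5, type4, ![0, 1, 4, 3, 2], 2⟩,
    ⟨5, type4, ![0, 2, 1, 3, 4], 2⟩, ⟨5, type4, ![0, 2, 1, 4, 3], 2⟩,
    -- acebd, adcbe, adecb, aecbd, aedcb
    ⟨5, type4, ![0, 2, 4, 1, 3], 2⟩, ⟨5, type4, ![0, 3, 2, 1, 4], 2⟩,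
    ⟨5, type4, ![0, 3, 4, 2, 1], 2⟩, ⟨5, type4, ![0, 4, 2, 1, 3], 2⟩,
    ⟨5, type4, ![0, 4, 3, 2, 1], 2⟩ ]

end UnavoidableSet

open UnavoidableSet in
/-- The set of configurations with outer connections. -/
def U3 : List Configuration :=
  withFourGon ++ (withType2e ++ withType4e ++ withType4d ++ withType4c)

/-- A set of configurations is unavoidable for a class of spherical curves if each curve of the
class has at least one member of the set. -/
def IsUnavoidable (U : List Configuration) (Cls : SphericalCurve → Prop) : Prop :=
  ∀ P : SphericalCurve, Cls P → ∃ C ∈ U, P.HasConfiguration C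

/-!
A crossing is isolated if the two loops into which it cuts the curve have no crossing in common; by
`IsTour.reducible` an isolated crossing makes the curve reducible. An inverse-half-twisted splice at
a crossing `x` of a curve that is not reducible always yields a spherical curve, and it turns the
cyclic word `x A x B` of crossings along the curve into the word of `A` reversed followed by `B`
(`IsTour.exists_splice`); the Euler characteristic is kept since two different faces are merged.
So the reductivity is at most the number of splices that a cyclic word needs to acquire an isolated
letter (`reductivity_le_of_untangles`), and the rest of the argument about splices is a matter of
words (`Untangles`).

The words show that three splices suffice if there is a 1-gon, a 2-gon, or a 3-gon that is not of
type D. Let the reductivity be four. The sides of a 4-gon or 5-gon next to a side shared with a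
3-gon of type D extend to the two other sides of the 3-gon, hence they are passed in the direction
opposite to that of the shared side. So no two 3-gons share a side, and at most three sides of a
5-gon are shared with 3-gons. Give each `n`-gon the charge `4 - n`, in total `8` by Euler's formula,
and let each 3-gon send a third of its charge across each side: only a 4-gon that shares a side with
a 3-gon can end up with a positive charge. Hence there is such a 4-gon (`exists_fourGon`), and
already the configurations with a 4-gon form an unavoidable set.

For a 4-gon with sides `a`, `b`, `c`, `d` that shares `d` with a 3-gon of type D, the tour passes
`a`, `d`, `c` in this cyclic order. The side `b` is passed in one of two directions and in one of
three gaps. Of the six resulting words three are untangled by three splices at vertices of the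
4-gon; the others are the two words of the list and the mirror image of one of them
(`FourGonTimes.hasConfiguration`).
-/

/-! ### Cyclic words and splices -/

/-- `Untangles k w`: at most `k` inverse-half-twisted splices turn the cyclic word `w` (the sequence
of crossings along a closed curve) into one with an isolated letter, i.e. a letter whose two
occurrences cut the word into two parts without a common letter. The splice at the letter `x`
deletes `x` and reverses one of the two parts between its occurrences. -/
inductive Untangles {α : Type} : ℕ → List α → Prop
  | of_isRotated_isolated {k : ℕ} {w : List α} (x : α) (A B : List α) :
      w ~r (x :: A ++ x :: B) → A.Disjoint B → Untangles k w
  | of_isRotated_splice {k : ℕ} {w : List α} (x : α) (A B : List α) :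
      w ~r (x :: A ++ x :: B) → Untangles k (A.reverse ++ B) → Untangles (k + 1) w

namespace Untangles

variable {α : Type} {k l : ℕ} {w w' : List α}

theorem congr (h : w ~r w') (hw : Untangles k w) : Untangles k w' := by
  cases hw with
  | of_isRotated_isolated x A B h1 h2 => exact .of_isRotated_isolated x A B (h.symm.trans h1) h2
  | of_isRotated_splice x A B h1 h2 => exact .of_isRotated_splice x A B (h.symm.trans h1) h2

theorem succ (h : Untangles k w) : Untangles (k + 1) w := by
  induction h with
  | of_isRotated_isolated x A B h1 h2 => exact .of_isRotated_isolated x A B h1 h2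
  | of_isRotated_splice x A B h1 _ ih => exact .of_isRotated_splice x A B h1 ih

theorem mono (hkl : k ≤ l) (h : Untangles k w) : Untangles l w := by
  induction hkl with
  | refl => exact h
  | step _ ih => exact ih.succ

theorem isRotated_append_cons (u v A : List α) (x : α) :
    (u ++ (x :: A ++ x :: v)) ~r (x :: A ++ x :: (v ++ u)) := by
  have h := List.isRotated_append (l := u) (l' := x :: A ++ x :: v)
  simpa using h

theorem isolated (u A v : List α) (x : α) (hw : w = u ++ (x :: A ++ x :: v))
    (h : A.Disjoint (v ++ u)) : Untangles k w := by
  subst hw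
  exact .of_isRotated_isolated x A (v ++ u) (isRotated_append_cons u v A x) h

theorem splice (u A v : List α) (x : α) (hw : w = u ++ (x :: A ++ x :: v))
    (h : Untangles k (A.reverse ++ (v ++ u))) : Untangles (k + 1) w := by
  subst hw
  exact .of_isRotated_splice x A (v ++ u) (isRotated_append_cons u v A x) h

theorem rotate (u v : List α) (hw : w = u ++ v) (h : Untangles k (v ++ u)) : Untangles k w := by
  subst hw
  exact congr List.isRotated_append h

/-- An incoherent 2-gon. -/
theorem bigon_same (x y : α) (A B : List α) :
    Untangles 1 (x :: y :: (A ++ x :: y :: B)) := by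
  refine splice [] (y :: A) (y :: B) x (by simp) ?_
  exact isolated A.reverse [] B y (by simp) (by simp)

/-- A 3-gon with sides `xy`, `xz`, `yz` passed in this order. -/
theorem triangle_incoherent (x y z : α) (A B C : List α) :
    Untangles 2 (x :: y :: (A ++ x :: z :: (B ++ y :: z :: C))) := by
  refine splice [] (y :: A) (z :: (B ++ y :: z :: C)) x (by simp) ?_
  refine splice A.reverse (z :: B) (z :: C) y (by simp) ?_
  exact isolated B.reverse [] (C ++ A.reverse) z (by simp) (by simp)

section Count

variable [DecidableEq α]

/-- A coherent 2-gon: the splice at a crossing of the two outer arcs makes it incoherent. -/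
theorem bigon_opposite (x y : α) (A B : List α)
    (hc : ∀ a, (x :: y :: (A ++ y :: x :: B)).count a ≤ 2) :
    Untangles 2 (x :: y :: (A ++ y :: x :: B)) := by
  by_cases h : ∃ c ∈ A, c ∈ B
  · obtain ⟨c, hA, hB⟩ := h
    obtain ⟨A₁, A₂, rfl⟩ := List.append_of_mem hA
    obtain ⟨B₁, B₂, rfl⟩ := List.append_of_mem hB
    refine splice (x :: y :: A₁) (A₂ ++ y :: x :: B₁) B₂ c (by simp) ?_
    refine rotate (B₁.reverse) (x :: y :: (A₂.reverse ++ (B₂ ++ x :: y :: A₁))) (by simp) ?_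
    convert bigon_same x y (A₂.reverse ++ B₂) (A₁ ++ B₁.reverse) using 1
    simp
  · refine isolated [x] A (x :: B) y (by simp) ?_
    intro a ha hb
    have hx := hc x
    have hA : 0 < A.count a := List.count_pos_iff.2 ha
    simp only [List.cons_append, List.mem_cons, List.mem_append, List.not_mem_nil, or_false] at hb
    rcases hb with rfl | hb | rfl
    · simp [List.count_cons] at hx; omega
    · exact h ⟨a, ha, hb⟩
    · simp [List.count_cons] at hx; omega

/-- A 3-gon with sides `xy`, `yz`, `xz` passed in this order. The arc from the first to the second
side has to cross the rest of the curve, or else `y` is isolated; the splice at such a crossing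
leads to an incoherent 2-gon after one more splice. -/
theorem triangle_incoherent' (x y z : α) (A B C : List α)
    (hc : ∀ a, (x :: y :: (A ++ y :: z :: (B ++ x :: z :: C))).count a ≤ 2) :
    Untangles 3 (x :: y :: (A ++ y :: z :: (B ++ x :: z :: C))) := by
  by_cases h : ∃ c ∈ A, c ∈ B
  · obtain ⟨c, hA, hB⟩ := h
    obtain ⟨A₁, A₂, rfl⟩ := List.append_of_mem hA
    obtain ⟨B₁, B₂, rfl⟩ := List.append_of_mem hB
    refine splice (x :: y :: A₁) (A₂ ++ y :: z :: B₁) (B₂ ++ x :: z :: C) c (by simp) ?_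
    refine rotate (B₁.reverse ++ z :: y :: (A₂.reverse ++ B₂ ++ x :: z :: C))
      (x :: y :: A₁) (by simp) ?_
    refine splice [x] (A₁ ++ B₁.reverse ++ [z]) (A₂.reverse ++ B₂ ++ x :: z :: C) y (by simp) ?_
    refine rotate (z :: (B₁ ++ A₁.reverse ++ A₂.reverse ++ B₂ ++ x :: z :: C)) [x] (by simp) ?_
    convert bigon_same x z (B₁ ++ A₁.reverse ++ A₂.reverse ++ B₂) C using 1
    simp
  by_cases h' : ∃ c ∈ A, c ∈ C
  · obtain ⟨c, hA, hC⟩ := h'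
    obtain ⟨A₁, A₂, rfl⟩ := List.append_of_mem hA
    obtain ⟨C₁, C₂, rfl⟩ := List.append_of_mem hC
    refine splice (x :: y :: A₁) (A₂ ++ y :: z :: (B ++ x :: z :: C₁)) C₂ c (by simp) ?_
    refine rotate (C₁.reverse ++ z :: x :: (B.reverse ++ z :: y :: (A₂.reverse ++ C₂)))
      (x :: y :: A₁) (by simp) ?_
    refine splice [x] (A₁ ++ C₁.reverse ++ z :: x :: (B.reverse ++ [z])) (A₂.reverse ++ C₂) y
      (by simp) ?_
    refine rotate (z :: (B ++ x :: z :: (C₁ ++ A₁.reverse ++ A₂.reverse ++ C₂))) [x]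
      (by simp) ?_
    convert bigon_same x z B (C₁ ++ A₁.reverse ++ A₂.reverse ++ C₂) using 1
    simp
  · refine isolated [x] A (z :: (B ++ x :: z :: C)) y (by simp) ?_
    intro a ha hb
    have hx := hc x
    have hz := hc z
    have hA : 0 < A.count a := List.count_pos_iff.2 ha
    simp only [List.cons_append, List.mem_cons, List.mem_append, List.not_mem_nil, or_false] at hb
    rcases hb with rfl | (hb | rfl | rfl | hb) | rfl
    · simp [List.count_cons] at hz; omega
    · exact h ⟨a, ha, hb⟩
    · simp [List.count_cons] at hx; omega
    · simp [List.count_cons] at hz; omega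
    · exact h' ⟨a, ha, hb⟩
    · simp [List.count_cons] at hx; omega

end Count

/-- The 3-gon of `triangle_coherent` if the first and the third outer arc cross each other: the
splice at such a crossing makes the 3-gon incoherent. -/
theorem triangle_coherent_of_crossing (x y z c : α) (A B C : List α) (hA : c ∈ A) (hC : c ∈ C) :
    Untangles 3 (x :: y :: (A ++ z :: x :: (B ++ y :: z :: C))) := by
  obtain ⟨A₁, A₂, rfl⟩ := List.append_of_mem hA
  obtain ⟨C₁, C₂, rfl⟩ := List.append_of_mem hC
  refine splice (x :: y :: A₁) (A₂ ++ z :: x :: (B ++ y :: z :: C₁)) C₂ c (by simp) ?_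
  refine rotate (C₁.reverse ++ z :: y :: B.reverse) (x :: z :: (A₂.reverse ++ C₂ ++ x :: y :: A₁))
    (by simp) ?_
  convert triangle_incoherent x z y (A₂.reverse ++ C₂) (A₁ ++ C₁.reverse) B.reverse using 1
  simp

/-- A coherent 3-gon whose sides `xy`, `zx`, `yz` are passed in this order, i.e. one that is not of
type D. If no two of the outer arcs cross each other, then `z` becomes isolated by the splices at
`x` and `y`. -/
theorem triangle_coherent (x y z : α) (A B C : List α) :
    Untangles 3 (x :: y :: (A ++ z :: x :: (B ++ y :: z :: C))) := by
  by_cases h1 : ∃ c ∈ A, c ∈ C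
  · obtain ⟨c, hA, hC⟩ := h1
    exact triangle_coherent_of_crossing x y z c A B C hA hC
  by_cases h2 : ∃ c ∈ B, c ∈ C
  · obtain ⟨c, hB, hC⟩ := h2
    refine rotate (x :: y :: (A ++ z :: x :: B)) (y :: z :: C) (by simp) ?_
    convert triangle_coherent_of_crossing y z x c C A B hC hB using 1
    simp
  · refine mono (k := 2) (by norm_num) ?_
    refine splice [] (y :: (A ++ [z])) (B ++ y :: z :: C) x (by simp) ?_
    refine splice (z :: A.reverse) B (z :: C) y (by simp) ?_
    refine rotate B.reverse (z :: (C ++ z :: A.reverse)) (by simp) ?_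
    refine isolated [] C (A.reverse ++ B.reverse) z (by simp) ?_
    intro a ha hb
    simp only [List.append_nil, List.mem_append, List.mem_reverse] at hb
    exact hb.elim (fun hb => h1 ⟨a, hb, ha⟩) (fun hb => h2 ⟨a, hb, ha⟩)

/-- A 4-gon with three coherently oriented sides, passed in the order `adcb`, that shares the
side `d` with a coherent 3-gon. -/
theorem fourGon_oneOdd_adcb (t p q r s : α) (A B C D : List α) :
    Untangles 3 (t :: p :: q :: (A ++ p :: s :: (B ++ r :: s :: t :: (C ++ q :: r :: D)))) := by
  refine splice [t] (q :: A) (s :: (B ++ r :: s :: t :: (C ++ q :: r :: D))) p (by simp) ?_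
  refine splice A.reverse (s :: (B ++ r :: s :: t :: C)) (r :: (D ++ [t])) q (by simp) ?_
  refine splice (C.reverse ++ [t]) (r :: B.reverse) (r :: (D ++ t :: A.reverse)) s (by simp) ?_
  exact isolated B [] (D ++ t :: (A.reverse ++ C.reverse ++ [t])) r (by simp) (by simp)

/-- A 4-gon with alternately oriented sides, passed in the order `abdc`, that shares the side `d`
with a coherent 3-gon. -/
theorem fourGon_alternating_abdc (t p q r s : α) (A B C D : List α) :
    Untangles 3 (t :: p :: q :: (A ++ r :: q :: (B ++ p :: s :: (C ++ r :: s :: t :: D)))) := by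
  refine splice [t] (q :: (A ++ r :: q :: B)) (s :: (C ++ r :: s :: t :: D)) p (by simp) ?_
  refine splice B.reverse (r :: A.reverse) (s :: (C ++ r :: s :: t :: (D ++ [t]))) q (by simp) ?_
  refine splice A (s :: C) (s :: t :: (D ++ t :: B.reverse)) r (by simp) ?_
  exact isolated C.reverse [] (t :: (D ++ t :: (B.reverse ++ A))) s (by simp) (by simp)

/-- A 4-gon with alternately oriented sides, passed in the order `adbc`, that shares the side `d`
with a coherent 3-gon. -/
theorem fourGon_alternating_adbc (t p q r s : α) (A B C D : List α) :
    Untangles 3 (t :: p :: q :: (A ++ p :: s :: (B ++ r :: q :: (C ++ r :: s :: t :: D)))) := by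
  refine splice [t] (q :: A) (s :: (B ++ r :: q :: (C ++ r :: s :: t :: D))) p (by simp) ?_
  refine splice (A.reverse ++ [q]) (B ++ r :: q :: (C ++ [r])) (t :: (D ++ [t])) s (by simp) ?_
  refine splice [] (C.reverse ++ [q]) (B.reverse ++ t :: (D ++ t :: (A.reverse ++ [q]))) r
    (by simp) ?_
  exact isolated [] (C ++ B.reverse ++ t :: (D ++ t :: A.reverse)) [] q (by simp) (by simp)

end Untangles

/-! ### Cycles of permutations of a finite set -/

section Cycles

open Equiv

variable {X : Type} [Finite X]

theorem Equiv.Perm.SameCycle.invariant {f : Perm X} {x y : X} {p : X → Prop}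
    (h : f.SameCycle x y) (hp : ∀ z, p z → p (f z)) (hx : p x) : p y := by
  obtain ⟨n, rfl⟩ := h.exists_nat_pow_eq
  induction n with
  | zero => simpa using hx
  | succ n ih =>
    rw [pow_succ', Perm.mul_apply]
    exact hp _ (ih (Perm.sameCycle_pow_right.2 (.refl _ _)))

theorem Equiv.Perm.minimalPeriod_pos (f : Perm X) (x : X) : 0 < Function.minimalPeriod f x :=
  Function.IsPeriodicPt.minimalPeriod_pos (orderOf_pos f)
    (by rw [Function.IsPeriodicPt, Function.IsFixedPt, ← Perm.coe_pow, pow_orderOf_eq_one]; rfl)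

theorem Equiv.Perm.sameCycle_iff_exists_lt {f : Perm X} {x y : X} :
    f.SameCycle x y ↔ ∃ k < Function.minimalPeriod f x, f^[k] x = y := by
  constructor
  · intro h
    obtain ⟨n, rfl⟩ := h.exists_nat_pow_eq
    exact ⟨n % Function.minimalPeriod f x, Nat.mod_lt _ (f.minimalPeriod_pos x), by
      rw [Function.iterate_mod_minimalPeriod_eq, Perm.coe_pow]⟩
  · rintro ⟨k, -, rfl⟩
    rw [← Perm.coe_pow]
    exact Perm.sameCycle_pow_right.2 (.refl _ _)

theorem Equiv.Perm.SameCycle.minimalPeriod_eq {f : Perm X} {x y : X} (h : f.SameCycle x y) :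
    Function.minimalPeriod f x = Function.minimalPeriod f y := by
  refine h.invariant (p := fun z => Function.minimalPeriod f x = Function.minimalPeriod f z)
    (fun z hz => ?_) (Eq.refl _)
  rw [hz, Function.minimalPeriod_apply
    (Function.minimalPeriod_pos_iff_mem_periodicPts.1 (f.minimalPeriod_pos z))]

theorem Equiv.Perm.card_filter_sameCycle [Fintype X] [DecidableEq X] (f : Perm X) (x : X)
    [DecidablePred fun y => f.SameCycle x y] :
    (Finset.univ.filter fun y => f.SameCycle x y).card = Function.minimalPeriod f x := by
  have : (Finset.univ.filter fun y => f.SameCycle x y)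
      = (Finset.range (Function.minimalPeriod f x)).image fun k => f^[k] x := by
    ext y
    simp [Perm.sameCycle_iff_exists_lt]
  rw [this, Finset.card_image_of_injOn, Finset.card_range]
  intro i hi j hj h
  exact (Function.iterate_eq_iterate_iff_of_lt_minimalPeriod (by simpa using hi)
    (by simpa using hj)).1 h

theorem numCycles_eq_sum [Fintype X] (f : Perm X) :
    (numCycles f : ℚ) = ∑ x, 1 / (Function.minimalPeriod f x : ℚ) := by
  classical
  let π : X → Quotient (Perm.SameCycle.setoid f) := Quotient.mk _
  have : Fintype (Quotient (Perm.SameCycle.setoid f)) := Fintype.ofFinite _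
  rw [← Finset.sum_fiberwise (s := Finset.univ) (g := π), numCycles, Nat.card_eq_fintype_card,
    ← Finset.card_univ, Finset.card_eq_sum_ones, Nat.cast_sum]
  refine Finset.sum_congr rfl fun q _ => ?_
  obtain ⟨x, rfl⟩ := Quotient.exists_rep q
  have h1 : ∀ y, π y = Quotient.mk _ x ↔ f.SameCycle x y := fun y =>
    ⟨fun h => (Quotient.exact h).symm, fun h => Quotient.sound h.symm⟩
  have h2 : (Finset.univ.filter fun y => π y = Quotient.mk _ x)
      = Finset.univ.filter fun y => f.SameCycle x y := Finset.filter_congr fun y _ => h1 y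
  have h3 : ∀ y ∈ (Finset.univ.filter fun y => f.SameCycle x y),
      1 / (Function.minimalPeriod f y : ℚ) = 1 / (Function.minimalPeriod f x : ℚ) := by
    intro y hy
    rw [(Finset.mem_filter.1 hy).2.minimalPeriod_eq]
  rw [h2, Finset.sum_congr rfl h3, Finset.sum_const, f.card_filter_sameCycle, nsmul_eq_mul]
  have := f.minimalPeriod_pos x
  field_simp
  norm_num

theorem mul_numCycles_of_minimalPeriod (f : Perm X) {m : ℕ}
    (h : ∀ x, Function.minimalPeriod f x = m) : m * numCycles f = Nat.card X := by
  have := Fintype.ofFinite X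
  have h1 := numCycles_eq_sum f
  simp only [h, Finset.sum_const, Finset.card_univ, nsmul_eq_mul] at h1
  rw [Nat.card_eq_fintype_card]
  rcases isEmpty_or_nonempty X with hX | ⟨⟨x⟩⟩
  · simp at h1
    simp [h1]
  · have hm : (m : ℚ) ≠ 0 := by
      have := f.minimalPeriod_pos x
      rw [h] at this
      positivity
    field_simp at h1
    exact_mod_cast (mul_comm _ _).trans h1

/-- The first return map `g` of a permutation `h` to a set has the same cycles as `h`, here for
the case that one or two steps of `h` lead back to the set. -/
theorem sameCycle_firstReturn_iff {p : X → Prop} (h : Perm X) (g : Perm {x // p x})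
    (h1 : ∀ x : {x // p x}, p (h x) → (g x : X) = h x)
    (h2 : ∀ x : {x // p x}, ¬ p (h x) → (g x : X) = h (h x)) (x y : {x // p x}) :
    g.SameCycle x y ↔ h.SameCycle (x : X) y := by
  constructor
  · intro hxy
    refine hxy.invariant (p := fun y : {x // p x} => h.SameCycle (x : X) y) (fun z hz => ?_)
      (.refl _ _)
    by_cases hz' : p (h z)
    · rw [h1 z hz']
      exact Perm.sameCycle_apply_right.2 hz
    · rw [h2 z hz']
      exact Perm.sameCycle_apply_right.2 (Perm.sameCycle_apply_right.2 hz)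
  · intro hxy
    obtain ⟨n, hn⟩ := hxy.exists_nat_pow_eq
    rw [Perm.coe_pow] at hn
    clear hxy
    induction n using Nat.strong_induction_on generalizing x with
    | _ n ih =>
      match n with
      | 0 =>
        have : x = y := Subtype.ext hn
        rw [this]
      | n + 1 =>
        by_cases hx : p (h x)
        · refine Perm.sameCycle_apply_left.1 (ih n (by omega) (g x) ?_)
          rw [h1 x hx]
          exact hn
        · match n with
          | 0 =>
            exact absurd (by simpa [← hn] using y.2) hx
          | n + 1 =>
            refine Perm.sameCycle_apply_left.1 (ih n (by omega) (g x) ?_)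
            rw [h2 x hx]
            exact hn

variable [DecidableEq X]

/-- Composing with the transposition of two elements of different cycles merges the cycles. -/
theorem Equiv.Perm.sameCycle_swap_mul_swapped (f : Perm X) {a b : X} (hab : ¬ f.SameCycle a b) :
    (swap a b * f).SameCycle b a := by
  have hpos := f.minimalPeriod_pos b
  have key : ∀ j < Function.minimalPeriod f b, (swap a b * f)^[j] b = f^[j] b := by
    intro j
    induction j with
    | zero => intro _; rfl
    | succ j ih =>
      intro hj
      rw [Function.iterate_succ_apply', Function.iterate_succ_apply', ih (by omega), Perm.mul_apply,
        ← Function.iterate_succ_apply' (f := f)]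
      refine swap_apply_of_ne_of_ne (fun h => hab ?_) fun h => ?_
      · exact (Perm.sameCycle_iff_exists_lt.2 ⟨j + 1, hj, h⟩).symm
      · have := (Function.iterate_eq_iterate_iff_of_lt_minimalPeriod hj hpos).1
          (h.trans (Function.iterate_zero_apply f b).symm)
        omega
  obtain ⟨p, hp⟩ := Nat.exists_eq_add_of_lt hpos
  have hlast : (swap a b * f)^[p + 1] b = a := by
    rw [Function.iterate_succ_apply', key p (by omega), Perm.mul_apply,
      ← Function.iterate_succ_apply' (f := f)]
    have : f^[p + 1] b = b := by
      have := Function.iterate_minimalPeriod (f := f) (x := b)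
      rwa [hp, zero_add] at this
    rw [this, swap_apply_right]
  exact ⟨((p + 1 : ℕ) : ℤ), by rw [zpow_natCast, Perm.coe_pow, hlast]⟩

theorem Equiv.Perm.sameCycle_swap_mul_iff (f : Perm X) {a b : X} (hab : ¬ f.SameCycle a b)
    (x y : X) : (swap a b * f).SameCycle x y ↔ f.SameCycle x y ∨
      (f.SameCycle a x ∨ f.SameCycle b x) ∧ (f.SameCycle a y ∨ f.SameCycle b y) := by
  have hba := f.sameCycle_swap_mul_swapped hab
  constructor
  · intro h
    refine h.invariant (p := fun y => f.SameCycle x y ∨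
      (f.SameCycle a x ∨ f.SameCycle b x) ∧ (f.SameCycle a y ∨ f.SameCycle b y))
      (fun z hz => ?_) (Or.inl (.refl _ _))
    rw [Perm.mul_apply]
    by_cases h1 : f z = a
    · rw [h1, swap_apply_left]
      have hza : f.SameCycle z a := by rw [← h1]; exact Perm.sameCycle_apply_right.2 (.refl _ _)
      refine Or.inr ⟨?_, Or.inr (.refl _ _)⟩
      rcases hz with hz | hz
      · exact Or.inl (hz.trans hza).symm
      · exact hz.1
    by_cases h2 : f z = b
    · rw [h2, swap_apply_right]
      have hzb : f.SameCycle z b := by rw [← h2]; exact Perm.sameCycle_apply_right.2 (.refl _ _)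
      refine Or.inr ⟨?_, Or.inl (.refl _ _)⟩
      rcases hz with hz | hz
      · exact Or.inr (hz.trans hzb).symm
      · exact hz.1
    · rw [swap_apply_of_ne_of_ne h1 h2]
      simpa only [Perm.sameCycle_apply_right] using hz
  · have step : ∀ x y, f.SameCycle x y → (swap a b * f).SameCycle x y := by
      intro x y h
      refine h.invariant (p := fun y => (swap a b * f).SameCycle x y) (fun z hz => ?_) (.refl _ _)
      have hz' : (swap a b * f).SameCycle x (swap a b (f z)) :=
        hz.trans (Perm.sameCycle_apply_right.2 (.refl _ _))
      by_cases h1 : f z = a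
      · rw [h1, swap_apply_left] at hz'
        rw [h1]
        exact hz'.trans hba
      by_cases h2 : f z = b
      · rw [h2, swap_apply_right] at hz'
        rw [h2]
        exact hz'.trans hba.symm
      · rwa [swap_apply_of_ne_of_ne h1 h2] at hz'
    rintro (h | ⟨hx, hy⟩)
    · exact step _ _ h
    · have toA : ∀ z, f.SameCycle a z ∨ f.SameCycle b z → (swap a b * f).SameCycle a z := by
        rintro z (h | h)
        · exact step _ _ h
        · exact hba.symm.trans (step _ _ h)
      exact (toA x hx).symm.trans (toA y hy)

/-- If two cycles of `f` are merged by a transposition and one then passes to the first return map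
`g`, the number of cycles drops by one. -/
theorem numCycles_merge {p : X → Prop} (f : Perm X) {a b : X} (hab : ¬ f.SameCycle a b)
    (g : Perm {x // p x}) (hg : ∀ x y, g.SameCycle x y ↔ (swap a b * f).SameCycle (x : X) y)
    (hp : ∀ x, ∃ y, p y ∧ f.SameCycle x y) : numCycles g + 1 = numCycles f := by
  classical
  have hrel : ∀ x y : {x // p x}, g.SameCycle x y ↔ f.SameCycle (x : X) y ∨
      (f.SameCycle a x ∨ f.SameCycle b x) ∧ (f.SameCycle a y ∨ f.SameCycle b y) := fun x y => by
    rw [hg, f.sameCycle_swap_mul_iff hab]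
  let cyc : X → Quotient (Perm.SameCycle.setoid f) := Quotient.mk _
  have hcyc : ∀ x y, cyc x = cyc y ↔ f.SameCycle x y := fun x y =>
    ⟨fun h => Quotient.exact h, fun h => Quotient.sound h⟩
  let ψ₀ : {x // p x} → {q : Quotient (Perm.SameCycle.setoid f) // q ≠ cyc b} := fun x =>
    if h : f.SameCycle b x then ⟨cyc a, fun h' => hab ((hcyc _ _).1 h')⟩
    else ⟨cyc x, fun h' => h ((hcyc _ _).1 h').symm⟩
  have hψ₀ : ∀ x y, ψ₀ x = ψ₀ y ↔ g.SameCycle x y := by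
    intro x y
    rw [hrel]
    have hba : ¬ f.SameCycle b a := fun h => hab h.symm
    by_cases hx : f.SameCycle b x <;> by_cases hy : f.SameCycle b y
    · simp [ψ₀, hx, hy]
    · simp only [ψ₀, hx, hy, dif_pos, dif_neg, not_false_eq_true, Subtype.mk.injEq, hcyc, or_true,
        true_and, or_false]
      exact ⟨Or.inr, fun h => h.elim (fun h => absurd (hx.trans h) hy) id⟩
    · simp only [ψ₀, hx, hy, dif_pos, dif_neg, not_false_eq_true, Subtype.mk.injEq, hcyc, or_true,
        and_true, or_false]
      exact ⟨fun h => Or.inr h.symm, fun h => h.elim (fun h => absurd (hy.trans h.symm) hx)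
        fun h => h.symm⟩
    · simp only [ψ₀, hx, hy, dif_neg, not_false_eq_true, Subtype.mk.injEq, hcyc, or_false]
      exact ⟨Or.inl, fun h => h.elim id fun h => h.1.symm.trans h.2⟩
  let ψ : Quotient (Perm.SameCycle.setoid g) →
      {q : Quotient (Perm.SameCycle.setoid f) // q ≠ cyc b} :=
    Quotient.lift ψ₀ fun x y h => (hψ₀ x y).2 h
  have hψ : Function.Bijective ψ := by
    constructor
    · intro q r
      induction q using Quotient.inductionOn with | _ x => ?_
      induction r using Quotient.inductionOn with | _ y => ?_
      intro h
      exact Quotient.sound ((hψ₀ x y).1 h)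
    · rintro ⟨q, hq⟩
      induction q using Quotient.inductionOn with | _ x => ?_
      obtain ⟨y, hy, hxy⟩ := hp x
      refine ⟨Quotient.mk _ ⟨y, hy⟩, ?_⟩
      have hby : ¬ f.SameCycle b y := fun h => hq ((hcyc x b).2 (hxy.trans h.symm))
      change ψ₀ ⟨y, hy⟩ = _
      simp only [ψ₀, hby, dif_neg, not_false_eq_true, Subtype.mk.injEq]
      exact (hcyc y x).2 hxy.symm
  have : Fintype (Quotient (Perm.SameCycle.setoid f)) := Fintype.ofFinite _
  have hcard := Fintype.card_subtype_compl fun q : Quotient (Perm.SameCycle.setoid f) => q = cyc b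
  have hpos : 0 < Fintype.card (Quotient (Perm.SameCycle.setoid f)) :=
    Fintype.card_pos_iff.2 ⟨cyc b⟩
  rw [Fintype.card_subtype_eq] at hcard
  rw [numCycles, numCycles, Nat.card_congr (Equiv.ofBijective ψ hψ), Nat.card_eq_fintype_card,
    Nat.card_eq_fintype_card, hcard]
  omega

end Cycles

/-! ### Tours along a spherical curve and their words -/

namespace SphericalCurve

variable {P : SphericalCurve}

instance : Finite P.Dart := P.finite

theorem rot_symm (d : P.Dart) : P.rot.symm d = P.rot (P.rot (P.rot d)) := by
  rw [Equiv.symm_apply_eq, P.rot_four]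

theorem rot_ne (d : P.Dart) : P.rot d ≠ d := fun h => P.rot_two_ne d (by rw [h, h])

theorem rot_three_ne (d : P.Dart) : P.rot (P.rot (P.rot d)) ≠ d := fun h => P.rot_ne d (by
  conv_lhs => rw [← h]
  exact P.rot_four d)

theorem face_apply (d : P.Dart) : P.face d = P.rot (P.rot (P.rot (P.opp d))) :=
  P.rot_symm (P.opp d)

theorem rot_face (d : P.Dart) : P.rot (P.face d) = P.opp d := P.rot.apply_symm_apply _

theorem atCrossing_iff {c x : P.Dart} : P.AtCrossing c x ↔
    x = c ∨ x = P.rot c ∨ x = P.rot (P.rot c) ∨ x = P.rot (P.rot (P.rot c)) := by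
  constructor
  · intro h
    refine Equiv.Perm.SameCycle.invariant h (p := fun x =>
      x = c ∨ x = P.rot c ∨ x = P.rot (P.rot c) ∨ x = P.rot (P.rot (P.rot c))) ?_ (Or.inl rfl)
    rintro z (rfl | rfl | rfl | rfl) <;> simp [P.rot_four]
  · rintro (rfl | rfl | rfl | rfl) <;>
      simp only [AtCrossing, Equiv.Perm.sameCycle_apply_right] <;> exact .refl _ _

theorem sameCycle_rot_face (d : P.Dart) : P.rot.SameCycle (P.opp d) (P.face d) := by
  rw [← Equiv.Perm.sameCycle_apply_right, P.rot_face]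

theorem sameCycle_rot_ahead (d : P.Dart) : P.rot.SameCycle (P.opp d) (P.ahead d) := by
  rw [ahead, Equiv.Perm.sameCycle_apply_right, Equiv.Perm.sameCycle_apply_right]

/-- Going straight ahead turns left twice, the next side of a face is reached by turning left
three times. -/
theorem ahead_ne_face (d : P.Dart) : P.ahead d ≠ P.face d := by
  rw [face_apply, ahead]
  exact fun h => P.rot_ne _ h.symm

/-- `ahead` as a permutation of the darts. Its cycles are the curve in its two orientations. -/
def aheadPerm (P : SphericalCurve) : Equiv.Perm P.Dart := P.opp.trans (P.rot.trans P.rot)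

@[simp] theorem coe_aheadPerm : ⇑P.aheadPerm = P.ahead := rfl

@[simp] theorem aheadPerm_apply (d : P.Dart) : P.aheadPerm d = P.ahead d := rfl

theorem ahead_injective : Function.Injective P.ahead := P.aheadPerm.injective

/-- The curve run through backwards. -/
theorem ahead_opp_ahead (d : P.Dart) : P.ahead (P.opp (P.ahead d)) = P.opp d := by
  simp [ahead, P.opp_opp, P.rot_four]

theorem sameCycle_ahead_opp {x y : P.Dart} (h : P.aheadPerm.SameCycle x y) :
    P.aheadPerm.SameCycle (P.opp x) (P.opp y) := by
  refine h.invariant (p := fun y => P.aheadPerm.SameCycle (P.opp x) (P.opp y)) (fun z hz => ?_)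
    (.refl _ _)
  rw [← Equiv.Perm.sameCycle_apply_right, aheadPerm_apply, aheadPerm_apply, ahead_opp_ahead]
  exact hz

theorem sameCycle_ahead_or (x y : P.Dart) :
    P.aheadPerm.SameCycle x y ∨ P.aheadPerm.SameCycle x (P.opp y) := by
  obtain ⟨k, h⟩ := P.single x y
  have : ∀ z, P.ahead^[k] x = z → P.aheadPerm.SameCycle x z := by
    rintro z rfl
    rw [← coe_aheadPerm, ← Equiv.Perm.coe_pow]
    exact Equiv.Perm.sameCycle_pow_right.2 (.refl _ _)
  exact h.imp (this _) (this _)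

/-- No tour in one direction passes an edge in both directions: halfway between the two passages
the curve would have to turn back. -/
theorem not_sameCycle_ahead_opp (x : P.Dart) : ¬ P.aheadPerm.SameCycle x (P.opp x) := by
  intro h
  obtain ⟨k, hk⟩ := h.exists_nat_pow_eq
  rw [Equiv.Perm.coe_pow, coe_aheadPerm] at hk
  clear h
  induction k using Nat.strong_induction_on generalizing x with
  | _ k ih =>
    match k with
    | 0 => exact P.opp_ne x hk.symm
    | 1 => exact P.rot_two_ne _ hk
    | k + 2 =>
      refine ih k (by omega) (P.ahead x) (P.ahead_injective ?_)
      rw [ahead_opp_ahead, ← Function.iterate_succ_apply' (f := P.ahead)]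
      exact hk

/-- The darts along one tour of the curve, as a cyclic list: each branch of each crossing is left
once, in one of its two directions. -/
structure IsTour (P : SphericalCurve) (L : List P.Dart) : Prop where
  chain : Cycle.Chain (fun x y => P.ahead x = y) (L : Cycle P.Dart)
  nodup : L.Nodup
  mem_or : ∀ y, y ∈ L ∨ P.rot (P.rot y) ∈ L
  not_mem : ∀ y ∈ L, P.rot (P.rot y) ∉ L

theorem IsTour.congr {L L' : List P.Dart} (h : P.IsTour L) (hL : L ~r L') : P.IsTour L' where
  chain := by
    have : (L : Cycle P.Dart) = L' := Quotient.sound hL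
    exact this ▸ h.chain
  nodup := hL.nodup_iff.1 h.nodup
  mem_or y := by simpa only [hL.mem_iff] using h.mem_or y
  not_mem y := by simpa only [hL.mem_iff] using h.not_mem y

theorem isTour_range (x : P.Dart) :
    P.IsTour ((List.range (Function.minimalPeriod P.ahead x)).map fun n => P.ahead^[n] x) := by
  have hx : x ∈ Function.periodicPts P.ahead :=
    Function.minimalPeriod_pos_iff_mem_periodicPts.1 (P.aheadPerm.minimalPeriod_pos x)
  have hmem : ∀ y, y ∈ (List.range (Function.minimalPeriod P.ahead x)).map
      (fun n => P.ahead^[n] x) ↔ P.aheadPerm.SameCycle x y := by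
    intro y
    rw [Equiv.Perm.sameCycle_iff_exists_lt]
    simp [eq_comm]
  refine ⟨?_, ?_, fun y => ?_, fun y => ?_⟩
  · have := (Function.periodicOrbit_chain' (fun x y => P.ahead x = y) hx).2
      fun n => (Function.iterate_succ_apply' P.ahead n x).symm
    rwa [Function.periodicOrbit_def] at this
  · have := Function.nodup_periodicOrbit (f := P.ahead) (x := x)
    rwa [Function.periodicOrbit_def] at this
  · rw [hmem, hmem]
    refine (P.sameCycle_ahead_or x y).imp id fun h => ?_
    have := Equiv.Perm.sameCycle_apply_right.2 h
    rwa [aheadPerm_apply, ahead, P.opp_opp] at this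
  · rw [hmem, hmem]
    intro h1 h2
    have h3 : P.rot (P.rot y) = P.aheadPerm (P.opp y) := by
      rw [aheadPerm_apply, ahead, P.opp_opp]
    rw [h3, Equiv.Perm.sameCycle_apply_right] at h2
    exact P.not_sameCycle_ahead_opp y (h1.symm.trans h2)

/-- `w` is a Gauss word of `P`: the cyclic sequence of the crossings along a tour, where `κ` names
the crossing of a dart. -/
def IsGaussWord (P : SphericalCurve) {α : Type} (κ : P.Dart → α) (w : List α) : Prop :=
  (∀ x y, κ x = κ y ↔ P.rot.SameCycle x y) ∧ ∃ L, P.IsTour L ∧ w = L.map κ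

theorem IsGaussWord.count_le_two {α : Type} [DecidableEq α] {κ : P.Dart → α} {w : List α}
    (h : P.IsGaussWord κ w) (a : α) : w.count a ≤ 2 := by
  obtain ⟨hκ, L, hL, rfl⟩ := h
  rw [List.count_eq_countP, List.countP_map, List.countP_eq_length_filter]
  set F := L.filter ((fun b => b == a) ∘ κ) with hF
  have hmem : ∀ y, y ∈ F ↔ y ∈ L ∧ κ y = a := by simp [hF]
  have hnodup : F.Nodup := hL.nodup.filter _
  have hle : ∀ u v : P.Dart, (∀ y ∈ F, y = u ∨ y = v) → F.length ≤ 2 := by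
    intro u v huv
    exact (List.subperm_of_subset hnodup (l₂ := [u, v]) fun y hy => by simpa using huv y hy).length_le
  rcases F.eq_nil_or_concat with h0 | ⟨_, z, h0⟩
  · simp [h0]
  have hz : z ∈ F := by simp [h0]
  have hz' := (hmem z).1 hz
  have hpos : ∀ y ∈ F, y = z ∨ y = P.rot z ∨ y = P.rot (P.rot (P.rot z)) := by
    intro y hy
    have hy' := (hmem y).1 hy
    have : P.AtCrossing z y := (hκ z y).1 (hz'.2.trans hy'.2.symm)
    rcases atCrossing_iff.1 this with h | h | rfl | h
    · exact Or.inl h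
    · exact Or.inr (Or.inl h)
    · exact absurd hy'.1 (hL.not_mem z hz'.1)
    · exact Or.inr (Or.inr h)
  by_cases hr : P.rot z ∈ L
  · refine hle z (P.rot z) fun y hy => ?_
    rcases hpos y hy with h | h | rfl
    · exact Or.inl h
    · exact Or.inr h
    · exact absurd ((hmem _).1 hy).1 (hL.not_mem _ hr)
  · refine hle z (P.rot (P.rot (P.rot z))) fun y hy => ?_
    rcases hpos y hy with h | rfl | h
    · exact Or.inl h
    · exact absurd ((hmem _).1 hy).1 hr
    · exact Or.inr h

theorem IsGaussWord.exists_tour {α : Type} {κ : P.Dart → α} {w : List α} (h : P.IsGaussWord κ w)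
    {x : α} {A B : List α} (hw : w ~r (x :: A ++ x :: B)) :
    ∃ (c₁ c₂ : P.Dart) (A' B' : List P.Dart), P.IsTour (c₁ :: A' ++ c₂ :: B') ∧
      κ c₁ = κ c₂ ∧ A = A'.map κ ∧ B = B'.map κ := by
  obtain ⟨-, L, hL, rfl⟩ := h
  obtain ⟨n, hn⟩ := hw
  rw [← List.map_rotate] at hn
  obtain ⟨L₁, L₂, hL₁₂, h₁, h₂⟩ := List.map_eq_append_iff.1 hn
  obtain ⟨c₁, A', rfl, hc₁, hA'⟩ := List.map_eq_cons_iff.1 h₁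
  obtain ⟨c₂, B', rfl, hc₂, hB'⟩ := List.map_eq_cons_iff.1 h₂
  exact ⟨c₁, c₂, A', B', hL₁₂ ▸ hL.congr ⟨n, rfl⟩, hc₁.trans hc₂.symm, hA'.symm, hB'.symm⟩

end SphericalCurve

/-! ### Closed chains -/

section ClosedChain

variable {X : Type} {a : X → X}

theorem List.IsChain.exists_iterate_eq {x y : X} {T : List X}
    (h : (x :: T).IsChain fun x y => a x = y) (hy : y ∈ T) : ∃ k, a^[k + 1] x = y := by
  induction T generalizing x with
  | nil => simp at hy
  | cons z T ih =>
    rw [List.isChain_cons_cons] at h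
    rcases List.mem_cons.1 hy with rfl | hy
    · exact ⟨0, h.1⟩
    · obtain ⟨k, hk⟩ := ih h.2 hy
      exact ⟨k + 1, by rw [Function.iterate_succ_apply, h.1, hk]⟩

theorem List.IsChain.apply_mem {u v y : X} {A : List X}
    (h : (u :: (A ++ [v])).IsChain fun x y => a x = y) (hy : y ∈ u :: A) : a y ∈ A ++ [v] := by
  induction A generalizing u with
  | nil =>
    rw [List.mem_singleton.1 hy]
    simpa using h
  | cons z A ih =>
    rw [List.cons_append, List.isChain_cons_cons] at h
    rcases List.mem_cons.1 hy with rfl | hy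
    · simp [h.1]
    · exact List.mem_cons_of_mem _ (ih h.2 hy)

theorem List.IsChain.exists_apply_eq {u v y : X} {A : List X}
    (h : (u :: (A ++ [v])).IsChain fun x y => a x = y) (hy : y ∈ A ++ [v]) :
    ∃ z ∈ u :: A, a z = y := by
  induction A generalizing u with
  | nil =>
    rw [List.nil_append, List.mem_singleton] at hy
    subst hy
    exact ⟨u, by simp, by simpa using h⟩
  | cons z A ih =>
    rw [List.cons_append, List.isChain_cons_cons] at h
    rcases List.mem_cons.1 hy with rfl | hy
    · exact ⟨u, by simp, h.1⟩
    · obtain ⟨w, hw, hwy⟩ := ih h.2 hy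
      exact ⟨w, List.mem_cons_of_mem _ hw, hwy⟩

theorem Cycle.Chain.exists_rotation {L : List X}
    (h : Cycle.Chain (fun x y => a x = y) (L : Cycle X)) {x : X} (hx : x ∈ L) :
    ∃ T, L ~r (x :: T) ∧ (x :: (T ++ [x])).IsChain fun x y => a x = y := by
  obtain ⟨s, t, rfl⟩ := List.append_of_mem hx
  have hr : (s ++ x :: t) ~r (x :: (t ++ s)) := by
    simpa using List.isRotated_append (l := s) (l' := x :: t)
  refine ⟨t ++ s, hr, ?_⟩
  have he : ((s ++ x :: t : List X) : Cycle X) = ((x :: (t ++ s) : List X) : Cycle X) :=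
    Quotient.sound hr
  rw [he, Cycle.chain_coe_cons] at h
  exact h

theorem Cycle.Chain.apply_mem {L : List X} (h : Cycle.Chain (fun x y => a x = y) (L : Cycle X))
    {x : X} (hx : x ∈ L) : a x ∈ L := by
  obtain ⟨T, hr, hT⟩ := h.exists_rotation hx
  rw [hr.mem_iff]
  have := hT.apply_mem (y := x) (by simp)
  rw [List.mem_append, List.mem_singleton] at this
  exact List.mem_cons.2 this.symm

theorem Cycle.Chain.exists_apply_eq {L : List X}
    (h : Cycle.Chain (fun x y => a x = y) (L : Cycle X)) {x : X} (hx : x ∈ L) :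
    ∃ z ∈ L, a z = x := by
  obtain ⟨T, hr, hT⟩ := h.exists_rotation hx
  obtain ⟨z, hz, hzx⟩ := hT.exists_apply_eq (y := x) (by simp)
  exact ⟨z, hr.mem_iff.2 hz, hzx⟩

theorem Cycle.Chain.exists_iterate_eq {L : List X}
    (h : Cycle.Chain (fun x y => a x = y) (L : Cycle X)) {x y : X} (hx : x ∈ L) (hy : y ∈ L) :
    ∃ k, a^[k] x = y := by
  obtain ⟨T, hr, hT⟩ := h.exists_rotation hx
  have hy' := hr.mem_iff.1 hy
  obtain ⟨k, hk⟩ := hT.exists_iterate_eq (y := y)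
    (by rw [List.mem_append, List.mem_singleton]; exact (List.mem_cons.1 hy').symm)
  exact ⟨k + 1, hk⟩

/-- A closed tour that leaves each branch of each crossing (a pair `y`, `turn y`) in one of its two
directions shows that there is only one closed curve. -/
theorem exists_iterate_eq_or_of_chain {opp turn : X → X} (hopp : ∀ x, opp (opp x) = x)
    (hturn : ∀ x, turn (turn x) = x) {L : List X}
    (h : Cycle.Chain (fun x y => turn (opp x) = y) (L : Cycle X))
    (hL : ∀ y, y ∈ L ∨ turn y ∈ L) (x y : X) :
    ∃ k : ℕ, (fun d => turn (opp d))^[k] x = y ∨ (fun d => turn (opp d))^[k] x = opp y := by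
  set a : X → X := fun d => turn (opp d) with ha
  have h' : Cycle.Chain (fun x y => a x = y) (L : Cycle X) := h
  have hinj : Function.Injective a := by
    intro u v huv
    have := congrArg (fun z => opp (turn z)) huv
    simpa only [ha, hturn, hopp] using this
  have hrev : ∀ k u, a^[k] (opp (a^[k] u)) = opp u := by
    intro k
    induction k with
    | zero => intro u; rfl
    | succ k ih =>
      intro u
      rw [Function.iterate_succ_apply, Function.iterate_succ_apply' a k u]
      have : a (opp (a (a^[k] u))) = opp (a^[k] u) := by simp only [ha, hopp, hturn]
      rw [this, ih]
  have hback : ∀ k u v, a^[k] u = opp v → a^[k] v = opp u := by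
    intro k u v huv
    have := hrev k u
    rwa [huv, hopp] at this
  have hmem : ∀ z, z ∈ L ∨ opp z ∈ L := by
    intro z
    rcases hL (opp z) with hz | hz
    · exact Or.inr hz
    · obtain ⟨z', hz', he⟩ := h'.exists_apply_eq hz
      exact Or.inl (hinj (a₁ := z') (a₂ := z) he ▸ hz')
  rcases hmem x with hx | hx <;> rcases hmem y with hy | hy
  · obtain ⟨k, hk⟩ := h'.exists_iterate_eq hx hy
    exact ⟨k, Or.inl hk⟩
  · obtain ⟨k, hk⟩ := h'.exists_iterate_eq hx hy
    exact ⟨k, Or.inr hk⟩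
  · obtain ⟨k, hk⟩ := h'.exists_iterate_eq hy hx
    exact ⟨k, Or.inr (hback k _ _ hk)⟩
  · obtain ⟨k, hk⟩ := h'.exists_iterate_eq hy hx
    exact ⟨k, Or.inl (by simpa only [hopp] using hback k _ _ hk)⟩

end ClosedChain

/-! ### An isolated letter makes a curve reducible -/

namespace SphericalCurve

variable {P : SphericalCurve}

theorem opp_eq_of_ahead_eq {x y : P.Dart} (h : P.ahead x = y) : P.opp x = P.rot (P.rot y) := by
  rw [← h, ahead, P.rot_four]

theorem opp_rot_rot_of_ahead_eq {x y : P.Dart} (h : P.ahead x = y) :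
    P.opp (P.rot (P.rot y)) = x := by
  rw [← opp_eq_of_ahead_eq h, P.opp_opp]

/-- A tour passes each crossing only twice. -/
theorem IsTour.eq_or_eq_or_eq {L : List P.Dart} (h : P.IsTour L) {x y z : P.Dart} (hx : x ∈ L)
    (hy : y ∈ L) (hz : z ∈ L) (hxy : P.AtCrossing x y) (hxz : P.AtCrossing x z) :
    x = y ∨ x = z ∨ y = z := by
  rcases atCrossing_iff.1 hxy with hy' | hy' | hy' | hy'
  · exact Or.inl hy'.symm
  · rcases atCrossing_iff.1 hxz with hz' | hz' | hz' | hz'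
    · exact Or.inr (Or.inl hz'.symm)
    · exact Or.inr (Or.inr (hy'.trans hz'.symm))
    · exact absurd (hz' ▸ hz) (h.not_mem x hx)
    · exact absurd (hz' ▸ hz) (hy' ▸ h.not_mem y hy)
  · exact absurd (hy' ▸ hy) (h.not_mem x hx)
  · rcases atCrossing_iff.1 hxz with hz' | hz' | hz' | hz'
    · exact Or.inr (Or.inl hz'.symm)
    · exact absurd (hy' ▸ hy) (hz' ▸ h.not_mem z hz)
    · exact absurd (hz' ▸ hz) (h.not_mem x hx)
    · exact Or.inr (Or.inr (hy'.trans hz'.symm))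

section Split

variable {c₁ c₂ : P.Dart} {A B : List P.Dart}

theorem IsTour.isChain_left (h : P.IsTour (c₁ :: A ++ c₂ :: B)) :
    (c₁ :: (A ++ [c₂])).IsChain fun x y => P.ahead x = y := by
  have := h.chain
  rw [List.cons_append, Cycle.chain_coe_cons, List.append_assoc, List.cons_append,
    ← List.cons_append, List.isChain_split] at this
  exact this.1

theorem IsTour.isChain_right (h : P.IsTour (c₁ :: A ++ c₂ :: B)) :
    (c₂ :: (B ++ [c₁])).IsChain fun x y => P.ahead x = y := by
  have := h.chain
  rw [List.cons_append, Cycle.chain_coe_cons, List.append_assoc, List.cons_append,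
    ← List.cons_append, List.isChain_split] at this
  exact this.2

theorem IsTour.not_atCrossing_left (h : P.IsTour (c₁ :: A ++ c₂ :: B)) (hc : P.AtCrossing c₁ c₂)
    {y : P.Dart} (hy : y ∈ A) : ¬ P.AtCrossing c₁ y := by
  intro hy'
  have hn := h.nodup
  rcases h.eq_or_eq_or_eq (x := c₁) (y := c₂) (z := y) (by simp) (by simp) (by simp [hy]) hc hy' with
    rfl | rfl | rfl
  · simp at hn
  · simp [hy] at hn
  · simp only [List.cons_append, List.nodup_cons, List.nodup_append, List.mem_cons] at hn
    exact hn.2.2.2 c₂ hy c₂ (Or.inl rfl) rfl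

theorem IsTour.not_atCrossing_right (h : P.IsTour (c₁ :: A ++ c₂ :: B)) (hc : P.AtCrossing c₁ c₂)
    {y : P.Dart} (hy : y ∈ B) : ¬ P.AtCrossing c₁ y := by
  intro hy'
  have hn := h.nodup
  rcases h.eq_or_eq_or_eq (x := c₁) (y := c₂) (z := y) (by simp) (by simp) (by simp [hy]) hc hy' with
    rfl | rfl | rfl
  · simp at hn
  · simp [hy] at hn
  · simp only [List.cons_append, List.nodup_cons, List.nodup_append] at hn
    exact hn.2.2.1.1 hy

theorem IsTour.eq_rot_or_eq_rot (h : P.IsTour (c₁ :: A ++ c₂ :: B)) (hc : P.AtCrossing c₁ c₂) :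
    c₂ = P.rot c₁ ∨ c₁ = P.rot c₂ := by
  rcases atCrossing_iff.1 hc with h1 | h1 | h1 | h1
  · have hn := h.nodup
    subst h1
    simp at hn
  · exact Or.inl h1
  · exact absurd (by simp [h1]) (h.not_mem c₁ (by simp))
  · exact Or.inr (by rw [h1, P.rot_four])

/-- If the two loops into which a crossing cuts the curve have no crossing in common, then the
crossing makes the curve reducible: a face that starts at the crossing along one of the loops can
leave this loop at that crossing only. -/
theorem IsTour.reducible (h : P.IsTour (c₁ :: A ++ c₂ :: B)) (hc : P.AtCrossing c₁ c₂)
    (hAB : ∀ x ∈ A, ∀ y ∈ B, ¬ P.AtCrossing x y) : P.Reducible := by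
  have hAc : ∀ x ∈ A, ¬ P.AtCrossing c₁ x := fun x => h.not_atCrossing_left hc
  let S : P.Dart → Prop := fun y => ∃ x ∈ A, P.AtCrossing x y
  have hSrot : ∀ y, S y ↔ S (P.rot y) := fun y => by
    simp only [S, AtCrossing, Equiv.Perm.sameCycle_apply_right]
  have hSc : ∀ y, P.AtCrossing c₁ y → ¬ S y := by
    rintro y hy ⟨x, hx, hxy⟩
    exact hAc x hx (Equiv.Perm.SameCycle.trans hy (Equiv.Perm.SameCycle.symm hxy))
  have hSA : ∀ y, S y → y ∈ A ∨ P.rot (P.rot y) ∈ A := by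
    have key : ∀ y, S y → y ∈ c₁ :: A ++ c₂ :: B → y ∈ A := by
      rintro y ⟨x, hx, hxy⟩ hy
      simp only [List.mem_append, List.mem_cons] at hy
      rcases hy with (rfl | hy) | rfl | hy
      · exact absurd (Equiv.Perm.SameCycle.symm hxy) (hAc x hx)
      · exact hy
      · exact absurd (Equiv.Perm.SameCycle.trans hc (Equiv.Perm.SameCycle.symm hxy)) (hAc x hx)
      · exact absurd hxy (hAB x hx y hy)
    intro y hy
    exact (h.mem_or y).imp (key y hy) (key _ ((hSrot _).1 ((hSrot _).1 hy)))
  let T : P.Dart → Prop := fun y => S y ∨ y = c₁ ∨ y = P.rot (P.rot c₂)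
  have hfwd : ∀ y ∈ c₁ :: A, T (P.opp y) := by
    intro y hy
    have hn := h.isChain_left.apply_mem hy
    have ho := opp_eq_of_ahead_eq (x := y) rfl
    rw [List.mem_append, List.mem_singleton] at hn
    rcases hn with hn | hn
    · exact Or.inl (by rw [ho, ← hSrot, ← hSrot]; exact ⟨_, hn, .refl _ _⟩)
    · exact Or.inr (Or.inr (by rw [ho, hn]))
  have hbwd : ∀ y, P.rot (P.rot y) ∈ A ++ [c₂] → T (P.opp y) := by
    intro y hy
    obtain ⟨z, hz, hzy⟩ := h.isChain_left.exists_apply_eq hy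
    have ho := opp_rot_rot_of_ahead_eq hzy
    rw [P.rot_four] at ho
    rw [ho]
    rcases List.mem_cons.1 hz with rfl | hz
    · exact Or.inr (Or.inl rfl)
    · exact Or.inl ⟨z, hz, .refl _ _⟩
  have hT : ∀ y, T y → T (P.opp y) := by
    rintro y (hy | rfl | rfl)
    · rcases hSA y hy with hy | hy
      · exact hfwd y (List.mem_cons_of_mem _ hy)
      · exact hbwd y (List.mem_append_left _ hy)
    · exact hfwd y (by simp)
    · exact hbwd _ (by simp [P.rot_four])
  -- `d` and `rot d` are the two ends of the loop through `A`
  obtain ⟨d, hTd⟩ : ∃ d, ∀ y, T y ↔ S y ∨ y = d ∨ y = P.rot d := by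
    rcases h.eq_rot_or_eq_rot hc with h1 | h1
    · refine ⟨P.rot (P.rot c₂), fun y => ?_⟩
      simp only [T, h1, P.rot_four]
      rw [or_comm (a := y = c₁)]
    · refine ⟨c₁, fun y => ?_⟩
      simp only [T, h1]
  have hSd : ∀ y, P.AtCrossing d y → ¬ S y := by
    intro y hy
    refine hSc y (Equiv.Perm.SameCycle.trans ?_ hy)
    rcases (hTd c₁).1 (Or.inr (Or.inl rfl)) with h3 | h3 | h3
    · exact absurd h3 (hSc _ (.refl _ _))
    · rw [h3]
    · rw [h3, Equiv.Perm.sameCycle_apply_left]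
  refine ⟨P.rot d, ?_⟩
  by_contra hcon
  have hinv : ∀ y, P.face.SameCycle (P.rot d) y → T y := by
    intro y hy
    refine (hy.invariant (p := fun y => T y ∧ P.face.SameCycle (P.rot d) y) (fun z hz => ?_)
      ⟨(hTd _).2 (Or.inr (Or.inr rfl)), .refl _ _⟩).1
    have hz' : P.face.SameCycle (P.rot d) (P.face z) := Equiv.Perm.sameCycle_apply_right.2 hz.2
    refine ⟨?_, hz'⟩
    rw [hTd]
    rcases (hTd _).1 (hT z hz.1) with h1 | h1 | h1
    · rw [← P.rot_face, ← hSrot] at h1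
      exact Or.inl h1
    · rw [face_apply, h1] at hz'
      exact absurd hz' hcon
    · rw [face_apply, h1, P.rot_four]
      exact Or.inr (Or.inl rfl)
  have hlast := hT _ (hinv (P.face.symm (P.rot d))
    (by rw [Equiv.Perm.sameCycle_symm_apply_right]))
  rw [← P.rot_face, Equiv.apply_symm_apply, hTd] at hlast
  rcases hlast with h1 | h1 | h1
  · exact hSd _ (atCrossing_iff.2 (by simp)) h1
  · exact P.rot_two_ne _ h1
  · exact P.rot_ne _ h1

end Split

end SphericalCurve

/-! ### The spherical curve obtained by a splice -/

namespace SphericalCurve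

variable {P : SphericalCurve}

theorem atCrossing_rot (c x : P.Dart) : P.AtCrossing c (P.rot x) ↔ P.AtCrossing c x :=
  Equiv.Perm.sameCycle_apply_right

theorem reducible_of_opp_eq_rot {y : P.Dart} (h : P.opp y = P.rot y) : P.Reducible := by
  refine ⟨P.rot y, ?_⟩
  have : P.face (P.rot y) = P.rot (P.rot (P.rot y)) := by
    rw [face_apply, ← h, P.opp_opp, h]
  rw [← this, Equiv.Perm.sameCycle_apply_right]

/-- An edge with both ends at the same crossing bounds a 1-gon. -/
theorem not_atCrossing_opp (hP : ¬ P.Reducible) (y : P.Dart) : ¬ P.AtCrossing y (P.opp y) := by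
  intro h
  rcases atCrossing_iff.1 h with h | h | h | h
  · exact P.opp_ne y h
  · exact hP (reducible_of_opp_eq_rot h)
  · have hy : P.ahead y = y := by rw [ahead, h, P.rot_four]
    obtain ⟨k, hk⟩ := P.single y (P.rot y)
    change P.ahead^[k] y = _ ∨ P.ahead^[k] y = _ at hk
    rw [Function.iterate_fixed hy] at hk
    rcases hk with hk | hk
    · exact P.rot_ne y hk.symm
    · have h' := congrArg P.opp hk
      rw [P.opp_opp, h] at h'
      exact P.rot_ne _ h'
  · refine hP (reducible_of_opp_eq_rot (y := P.rot (P.rot (P.rot y))) ?_)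
    rw [← h, P.opp_opp, h, P.rot_four]

theorem atCrossing_opp_imp (hP : ¬ P.Reducible) {c y : P.Dart} (h : P.AtCrossing c y) :
    ¬ P.AtCrossing c (P.opp y) := fun h' =>
  not_atCrossing_opp hP y (Equiv.Perm.SameCycle.trans (Equiv.Perm.SameCycle.symm h) h')

section SpliceTurn

variable (c : P.Dart)

theorem spliceTurn_zero : P.spliceTurn c c = P.rot c := by simp [spliceTurn]

theorem spliceTurn_one : P.spliceTurn c (P.rot c) = c := by simp [spliceTurn, P.rot_ne]

theorem spliceTurn_two :
    P.spliceTurn c (P.rot (P.rot c)) = P.rot (P.rot (P.rot c)) := by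
  simp [spliceTurn, P.rot_ne, P.rot_two_ne]

theorem spliceTurn_three :
    P.spliceTurn c (P.rot (P.rot (P.rot c))) = P.rot (P.rot c) := by
  simp [spliceTurn, P.rot_ne, P.rot_two_ne, P.rot_three_ne]

theorem spliceTurn_of_not {x : P.Dart} (hx : ¬ P.AtCrossing c x) :
    P.spliceTurn c x = P.rot (P.rot x) := by
  rw [atCrossing_iff] at hx
  simp only [not_or] at hx
  simp [spliceTurn, hx.1, hx.2.1, hx.2.2.1, hx.2.2.2]

theorem spliceTurn_spliceTurn (x : P.Dart) : P.spliceTurn c (P.spliceTurn c x) = x := by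
  by_cases hx : P.AtCrossing c x
  · rcases atCrossing_iff.1 hx with rfl | rfl | rfl | rfl <;>
      simp only [spliceTurn_zero, spliceTurn_one, spliceTurn_two, spliceTurn_three]
  · rw [spliceTurn_of_not c hx, spliceTurn_of_not c (by simpa only [atCrossing_rot] using hx),
      P.rot_four]

theorem spliceTurn_ne {x : P.Dart} (hx : P.AtCrossing c x) : P.spliceTurn c x ≠ x := by
  rcases atCrossing_iff.1 hx with rfl | rfl | rfl | rfl <;>
    simp only [spliceTurn_zero, spliceTurn_one, spliceTurn_two, spliceTurn_three]
  · exact P.rot_ne _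
  · exact (P.rot_ne _).symm
  · exact P.rot_ne _
  · exact (P.rot_ne _).symm

theorem atCrossing_spliceTurn {x : P.Dart} (hx : P.AtCrossing c x) :
    P.AtCrossing c (P.spliceTurn c x) := by
  rcases atCrossing_iff.1 hx with rfl | rfl | rfl | rfl <;>
    simp only [spliceTurn_zero, spliceTurn_one, spliceTurn_two, spliceTurn_three, atCrossing_rot] <;>
    exact .refl _ _

open Classical in
/-- The other half of the edge of `x` after the splice at the crossing of `c`. As no edge has both
ends at this crossing, at most two edges are concatenated to a new one. -/
noncomputable def spliceOpp (x : P.Dart) : P.Dart :=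
  if P.AtCrossing c (P.opp x) then P.opp (P.spliceTurn c (P.opp x)) else P.opp x

theorem spliceOpp_of_atCrossing {x : P.Dart} (hx : P.AtCrossing c (P.opp x)) :
    P.spliceOpp c x = P.opp (P.spliceTurn c (P.opp x)) := if_pos hx

theorem spliceOpp_of_not {x : P.Dart} (hx : ¬ P.AtCrossing c (P.opp x)) :
    P.spliceOpp c x = P.opp x := if_neg hx

theorem not_atCrossing_spliceOpp (hP : ¬ P.Reducible) (x : P.Dart) :
    ¬ P.AtCrossing c (P.spliceOpp c x) := by
  by_cases hx : P.AtCrossing c (P.opp x)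
  · rw [spliceOpp_of_atCrossing c hx]
    exact atCrossing_opp_imp hP (atCrossing_spliceTurn c hx)
  · rwa [spliceOpp_of_not c hx]

theorem spliceOpp_spliceOpp {x : P.Dart} (hx' : ¬ P.AtCrossing c x) :
    P.spliceOpp c (P.spliceOpp c x) = x := by
  by_cases hx : P.AtCrossing c (P.opp x)
  · rw [spliceOpp_of_atCrossing c hx, spliceOpp_of_atCrossing, P.opp_opp, spliceTurn_spliceTurn,
      P.opp_opp]
    rw [P.opp_opp]
    exact atCrossing_spliceTurn c hx
  · rw [spliceOpp_of_not c hx, spliceOpp_of_not, P.opp_opp]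
    rwa [P.opp_opp]

theorem spliceOpp_ne (x : P.Dart) : P.spliceOpp c x ≠ x := by
  by_cases hx : P.AtCrossing c (P.opp x)
  · rw [spliceOpp_of_atCrossing c hx]
    intro h
    refine spliceTurn_ne c hx (P.opp.injective ?_)
    rw [h, P.opp_opp]
  · rw [spliceOpp_of_not c hx]
    exact P.opp_ne x

/-- The edges after the splice. -/
noncomputable def splicedOpp (hP : ¬ P.Reducible) : Equiv.Perm {x : P.Dart // ¬ P.AtCrossing c x} :=
  Function.Involutive.toPerm (fun x => ⟨P.spliceOpp c x, not_atCrossing_spliceOpp c hP x⟩)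
    fun x => Subtype.ext (spliceOpp_spliceOpp c x.2)

@[simp] theorem coe_splicedOpp (hP : ¬ P.Reducible) (x : {x : P.Dart // ¬ P.AtCrossing c x}) :
    (P.splicedOpp c hP x : P.Dart) = P.spliceOpp c x := rfl

/-- The crossings after the splice. -/
def splicedRot : Equiv.Perm {x : P.Dart // ¬ P.AtCrossing c x} :=
  P.rot.subtypePerm fun x => not_congr (atCrossing_rot c x)

@[simp] theorem coe_splicedRot (x : {x : P.Dart // ¬ P.AtCrossing c x}) :
    (P.splicedRot c x : P.Dart) = P.rot x := rfl

end SpliceTurn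

/-! ### The Euler characteristic of a splice -/

theorem minimalPeriod_eq_two {X : Type} {f : X → X} {x : X} (h : f (f x) = x) (h1 : f x ≠ x) :
    Function.minimalPeriod f x = 2 := by
  have hd : Function.minimalPeriod f x ∣ 2 := Function.IsPeriodicPt.minimalPeriod_dvd h
  rcases (Nat.dvd_prime Nat.prime_two).1 hd with hp | hp
  · exact absurd (Function.minimalPeriod_eq_one_iff_isFixedPt.1 hp) h1
  · exact hp

theorem minimalPeriod_eq_four {X : Type} {f : X → X} {x : X} (h : f (f (f (f x))) = x)
    (h2 : f (f x) ≠ x) : Function.minimalPeriod f x = 4 := by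
  have hd : Function.minimalPeriod f x ∣ 2 ^ 2 := Function.IsPeriodicPt.minimalPeriod_dvd h
  obtain ⟨k, hk, hp⟩ := (Nat.dvd_prime_pow Nat.prime_two).1 hd
  have hne : ¬ Function.minimalPeriod f x ∣ 2 := fun h' =>
    h2 (Function.isPeriodicPt_iff_minimalPeriod_dvd.2 h')
  interval_cases k
  · simp [hp] at hne
  · simp [hp] at hne
  · exact hp

theorem four_mul_numCycles_rot : 4 * numCycles P.rot = Nat.card P.Dart :=
  mul_numCycles_of_minimalPeriod _ fun x => minimalPeriod_eq_four (P.rot_four x) (P.rot_two_ne x)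

theorem two_mul_numCycles_opp : 2 * numCycles P.opp = Nat.card P.Dart :=
  mul_numCycles_of_minimalPeriod _ fun x => minimalPeriod_eq_two (P.opp_opp x) (P.opp_ne x)

theorem card_not_atCrossing (c : P.Dart) :
    Nat.card {x : P.Dart // ¬ P.AtCrossing c x} + 4 = Nat.card P.Dart := by
  classical
  have := Fintype.ofFinite P.Dart
  have h4 := P.rot.card_filter_sameCycle c
  rw [minimalPeriod_eq_four (P.rot_four c) (P.rot_two_ne c)] at h4
  have hc : Fintype.card {x : P.Dart // P.AtCrossing c x} = 4 := by
    rw [Fintype.card_subtype]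
    convert h4
    exact Iff.rfl
  have hcompl := Fintype.card_subtype_compl fun x => P.AtCrossing c x
  have hle := Fintype.card_subtype_le fun x => P.AtCrossing c x
  rw [Nat.card_eq_fintype_card, Nat.card_eq_fintype_card]
  omega

theorem not_atCrossing_face (hP : ¬ P.Reducible) {c y : P.Dart} (h : P.AtCrossing c y) :
    ¬ P.AtCrossing c (P.face y) := fun h' =>
  atCrossing_opp_imp hP h (Equiv.Perm.SameCycle.trans h' (sameCycle_rot_face y).symm)

/-- A splice merges the two faces at the two corners of the crossing that are joined by it, which
are different as the curve is not reducible. -/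
theorem numCycles_spliced_face (hP : ¬ P.Reducible) (c : P.Dart) :
    numCycles ((P.splicedOpp c hP).trans (P.splicedRot c).symm) + 1 = numCycles P.face := by
  classical
  set a := P.rot c with ha
  set b := P.rot (P.rot (P.rot c)) with hb
  have hab : ¬ P.face.SameCycle a b := fun h => hP ⟨P.rot c, h⟩
  have hface : ∀ x, P.AtCrossing c (P.face x) ↔ P.AtCrossing c (P.opp x) := fun x =>
    ⟨fun h => Equiv.Perm.SameCycle.trans h (sameCycle_rot_face x).symm,
      fun h => Equiv.Perm.SameCycle.trans h (sameCycle_rot_face x)⟩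
  have hswap_not : ∀ z, ¬ P.AtCrossing c z → Equiv.swap a b z = z := by
    intro z hz
    rw [atCrossing_iff] at hz
    simp only [not_or] at hz
    exact Equiv.swap_apply_of_ne_of_ne hz.2.1 hz.2.2.2
  have hswap_at : ∀ z, P.AtCrossing c (P.opp z) →
      Equiv.swap a b (P.face z) = P.spliceTurn c (P.opp z) := by
    intro z hz
    rw [face_apply]
    have h1 : c ≠ a := (P.rot_ne c).symm
    have h2 : c ≠ b := (P.rot_three_ne c).symm
    have h3 : P.rot (P.rot c) ≠ a := P.rot_ne _
    have h4 : P.rot (P.rot c) ≠ b := (P.rot_ne _).symm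
    rcases atCrossing_iff.1 hz with h | h | h | h
    · rw [h, spliceTurn_zero, ← hb, Equiv.swap_apply_right]
    · rw [h, spliceTurn_one, P.rot_four, Equiv.swap_apply_of_ne_of_ne h1 h2]
    · rw [h, spliceTurn_two, P.rot_four, ← ha, Equiv.swap_apply_left]
    · rw [h, spliceTurn_three, P.rot_four, Equiv.swap_apply_of_ne_of_ne h3 h4]
  refine numCycles_merge P.face hab _ (sameCycle_firstReturn_iff _ _ ?_ ?_) ?_
  · intro x hx
    have hval : (((P.splicedOpp c hP).trans (P.splicedRot c).symm x :
        {x : P.Dart // ¬ P.AtCrossing c x}) : P.Dart) = P.rot.symm (P.spliceOpp c x) := rfl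
    have hx' : ¬ P.AtCrossing c (P.opp x) := by
      intro h
      apply hx
      rw [Equiv.Perm.mul_apply, hswap_at _ h]
      exact atCrossing_spliceTurn c h
    rw [hval, spliceOpp_of_not c hx', Equiv.Perm.mul_apply, hswap_not _ (mt (hface _).1 hx')]
    rfl
  · intro x hx
    have hval : (((P.splicedOpp c hP).trans (P.splicedRot c).symm x :
        {x : P.Dart // ¬ P.AtCrossing c x}) : P.Dart) = P.rot.symm (P.spliceOpp c x) := rfl
    have hx' : P.AtCrossing c (P.opp x) := by
      by_contra h
      apply hx
      rw [Equiv.Perm.mul_apply, hswap_not _ (mt (hface _).1 h)]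
      exact mt (hface _).1 h
    rw [hval, spliceOpp_of_atCrossing c hx', Equiv.Perm.mul_apply, Equiv.Perm.mul_apply,
      hswap_at _ hx', hswap_not _ (not_atCrossing_face hP (atCrossing_spliceTurn c hx'))]
    rfl
  · intro x
    by_cases hx : P.AtCrossing c x
    · exact ⟨P.face x, not_atCrossing_face hP hx, Equiv.Perm.sameCycle_apply_right.2 (.refl _ _)⟩
    · exact ⟨x, hx, .refl _ _⟩

/-- The result of the splice at the crossing of `c`, given that it is a single curve. -/
noncomputable def spliced (hP : ¬ P.Reducible) (c : P.Dart)
    (hs : ∀ x y : {x : P.Dart // ¬ P.AtCrossing c x}, ∃ k : ℕ,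
      (fun d => P.splicedRot c (P.splicedRot c (P.splicedOpp c hP d)))^[k] x = y ∨
      (fun d => P.splicedRot c (P.splicedRot c (P.splicedOpp c hP d)))^[k] x
        = P.splicedOpp c hP y) : SphericalCurve where
  Dart := {x : P.Dart // ¬ P.AtCrossing c x}
  finite := inferInstance
  opp := P.splicedOpp c hP
  rot := P.splicedRot c
  opp_opp x := Subtype.ext (spliceOpp_spliceOpp c x.2)
  opp_ne x h := spliceOpp_ne c x (congrArg Subtype.val h)
  rot_four x := Subtype.ext (P.rot_four x)
  rot_two_ne x h := P.rot_two_ne x (congrArg Subtype.val h)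
  single := hs
  euler := by
    have h1 : 4 * numCycles (P.splicedRot c) = Nat.card {x : P.Dart // ¬ P.AtCrossing c x} :=
      mul_numCycles_of_minimalPeriod _ fun x => minimalPeriod_eq_four
        (Subtype.ext (P.rot_four x)) fun h => P.rot_two_ne x (congrArg Subtype.val h)
    have h2 : 2 * numCycles (P.splicedOpp c hP) = Nat.card {x : P.Dart // ¬ P.AtCrossing c x} :=
      mul_numCycles_of_minimalPeriod _ fun x => minimalPeriod_eq_two
        (Subtype.ext (spliceOpp_spliceOpp c x.2))
        fun h => spliceOpp_ne c x (congrArg Subtype.val h)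
    have h3 := P.four_mul_numCycles_rot
    have h4 := P.two_mul_numCycles_opp
    have h5 := P.card_not_atCrossing c
    have h6 := P.numCycles_spliced_face hP c
    have h7 : numCycles P.rot + numCycles P.face = numCycles P.opp + 2 := P.euler
    omega

/-! ### The word of a splice -/

section Chains

variable {u v w : P.Dart} {A : List P.Dart} {f : P.Dart → P.Dart}

/-- A stretch of a tour that is also run through forwards if one turns by `f` at the crossings. -/
theorem isChain_forward (h : (u :: (A ++ [v])).IsChain fun x y => P.ahead x = y)
    (hA : ∀ b ∈ A, f (P.rot (P.rot b)) = b) (hv : f (P.rot (P.rot v)) = w) :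
    (u :: (A ++ [w])).IsChain fun x y => f (P.opp x) = y := by
  induction A generalizing u with
  | nil =>
    have h' : P.ahead u = v := by simpa using h
    simp [opp_eq_of_ahead_eq h', hv]
  | cons b A ih =>
    rw [List.cons_append, List.isChain_cons_cons] at h ⊢
    exact ⟨by rw [opp_eq_of_ahead_eq h.1, hA b (by simp)],
      ih h.2 fun b' hb' => hA b' (List.mem_cons_of_mem _ hb')⟩

/-- A stretch of a tour that is run through backwards if one turns by `f` at the crossings. -/
theorem isChain_backward (h : (u :: A).IsChain fun x y => P.ahead x = y)
    (hA : ∀ b ∈ A, f b = P.rot (P.rot b)) :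
    (A.reverse.map (fun x => P.rot (P.rot x)) ++ [f u]).IsChain fun x y => f (P.opp x) = y := by
  induction A generalizing u with
  | nil => simp
  | cons b A ih =>
    rw [List.isChain_cons_cons] at h
    have := ih h.2 fun b' hb' => hA b' (List.mem_cons_of_mem _ hb')
    rw [hA b (by simp)] at this
    rw [List.reverse_cons, List.map_append, List.map_singleton, List.append_assoc,
      List.singleton_append, List.isChain_split]
    refine ⟨this, ?_⟩
    simp [opp_rot_rot_of_ahead_eq h.1]

end Chains

/-- The inverse-half-twisted splice at the crossing of `c₁` and `c₂` turns the tour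
`c₁ A c₂ B` into the tour that runs through `A` backwards and then through `B`. -/
theorem IsTour.exists_splice {α : Type} {κ : P.Dart → α} (hP : ¬ P.Reducible)
    {c₁ c₂ : P.Dart} {A B : List P.Dart} (h : P.IsTour (c₁ :: A ++ c₂ :: B))
    (hκ : ∀ x y, κ x = κ y ↔ P.rot.SameCycle x y) (hcc : κ c₁ = κ c₂) :
    ∃ (Q : SphericalCurve) (κ' : Q.Dart → α), HalfTwistedSplice P Q ∧
      Q.IsGaussWord κ' ((A.map κ).reverse ++ B.map κ) := by
  have hc12 : P.AtCrossing c₁ c₂ := (hκ _ _).1 hcc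
  obtain ⟨c, hc1, hσ1, hσ1'⟩ : ∃ c, P.AtCrossing c c₁ ∧ P.spliceTurn c c₁ = c₂ ∧
      P.spliceTurn c (P.rot (P.rot c₁)) = P.rot (P.rot c₂) := by
    rcases h.eq_rot_or_eq_rot hc12 with rfl | rfl
    · exact ⟨c₁, .refl _ _, spliceTurn_zero _, spliceTurn_two _⟩
    · exact ⟨c₂, (atCrossing_rot _ _).2 (.refl _ _), spliceTurn_one _, spliceTurn_three _⟩
  have hc2 : P.AtCrossing c c₂ := Equiv.Perm.SameCycle.trans hc1 hc12
  have hcA : ∀ x ∈ A, ¬ P.AtCrossing c x := fun x hx hx' => h.not_atCrossing_left hc12 hx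
    (Equiv.Perm.SameCycle.trans (Equiv.Perm.SameCycle.symm hc1) hx')
  have hcB : ∀ x ∈ B, ¬ P.AtCrossing c x := fun x hx hx' => h.not_atCrossing_right hc12 hx
    (Equiv.Perm.SameCycle.trans (Equiv.Perm.SameCycle.symm hc1) hx')
  have hrr : ∀ x, P.AtCrossing c (P.rot (P.rot x)) ↔ P.AtCrossing c x := fun x => by
    rw [atCrossing_rot, atCrossing_rot]
  have hahead : ∀ x y, P.AtCrossing c x → P.ahead x = y → ¬ P.AtCrossing c y := by
    rintro x y hx rfl hy
    exact atCrossing_opp_imp hP hx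
      (Equiv.Perm.SameCycle.trans hy (Equiv.Perm.SameCycle.symm (sameCycle_rot_ahead x)))
  have hchA := h.isChain_left
  have hchB := h.isChain_right
  -- neither loop is a single edge
  obtain ⟨A', z, rfl⟩ : ∃ A' z, A = A' ++ [z] := by
    rcases A.eq_nil_or_concat' with rfl | ⟨A', z, rfl⟩
    · exact absurd hc2 (hahead c₁ c₂ hc1 (by simpa using hchA))
    · exact ⟨A', z, rfl⟩
  obtain ⟨b, B', rfl⟩ : ∃ b B', B = b :: B' := by
    rcases B with - | ⟨b, B'⟩
    · exact absurd hc1 (hahead c₂ c₁ hc2 (by simpa using hchB))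
    · exact ⟨b, B', rfl⟩
  have hz : P.ahead z = c₂ := by
    rw [List.append_assoc, ← List.cons_append, List.singleton_append, List.isChain_split] at hchA
    simpa using hchA.2
  have hb : P.ahead c₂ = b := by
    rw [List.cons_append, List.isChain_cons_cons] at hchB
    exact hchB.1
  have hchA' : (c₁ :: (A' ++ [z])).IsChain fun x y => P.ahead x = y := hchA.left_of_append
    (l₁ := c₁ :: (A' ++ [z]))
  have hchB' : (b :: (B' ++ [c₁])).IsChain fun x y => P.ahead x = y := by
    rw [List.cons_append, List.isChain_cons_cons] at hchB
    exact hchB.2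
  -- `F` is the turn at a crossing that leads to the next dart of the new curve
  classical
  set F : P.Dart → P.Dart := fun y =>
    if P.AtCrossing c y then P.ahead (P.spliceTurn c y) else P.rot (P.rot y) with hF
  have hF1 : ∀ y, P.AtCrossing c y → F y = P.ahead (P.spliceTurn c y) := fun y hy => if_pos hy
  have hF2 : ∀ y, ¬ P.AtCrossing c y → F y = P.rot (P.rot y) := fun y hy => if_neg hy
  have hFopp : ∀ y, F (P.opp y) = P.rot (P.rot (P.spliceOpp c y)) := by
    intro y
    by_cases hy : P.AtCrossing c (P.opp y)
    · rw [hF1 _ hy, spliceOpp_of_atCrossing c hy, ahead]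
    · rw [hF2 _ hy, spliceOpp_of_not c hy]
  set L' : List P.Dart := (A' ++ [z]).reverse.map (fun x => P.rot (P.rot x)) ++ b :: B' with hL'
  have hmem : ∀ y, y ∈ L' ↔ P.rot (P.rot y) ∈ A' ++ [z] ∨ y ∈ b :: B' := by
    intro y
    rw [hL', List.mem_append, List.mem_map]
    refine or_congr ⟨?_, fun hy => ⟨P.rot (P.rot y), List.mem_reverse.2 hy, P.rot_four y⟩⟩ Iff.rfl
    rintro ⟨x, hx, rfl⟩
    rwa [P.rot_four, ← List.mem_reverse]
  have hL'c : ∀ y ∈ L', ¬ P.AtCrossing c y := by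
    intro y hy
    rcases (hmem y).1 hy with hy | hy
    · exact fun hy' => hcA _ hy ((hrr y).2 hy')
    · exact hcB y hy
  have hor : ∀ y, ¬ P.AtCrossing c y → y ∈ L' ∨ P.rot (P.rot y) ∈ L' := by
    intro y hy
    have key : ∀ x, ¬ P.AtCrossing c x → x ∈ c₁ :: (A' ++ [z]) ++ c₂ :: b :: B' →
        x ∈ A' ++ [z] ∨ x ∈ b :: B' := by
      intro x hx hxL
      rcases List.mem_append.1 hxL with hx' | hx' <;> rcases List.mem_cons.1 hx' with rfl | hx'
      · exact absurd hc1 hx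
      · exact Or.inl hx'
      · exact absurd hc2 hx
      · exact Or.inr hx'
    rw [hmem, hmem, P.rot_four]
    have h1 := (h.mem_or y).imp (key y hy) (key _ (mt (hrr y).1 hy))
    tauto
  have hnot : ∀ y ∈ L', P.rot (P.rot y) ∉ L' := by
    intro y hy hy'
    rw [hmem] at hy hy'
    rw [P.rot_four] at hy'
    have hsubA : ∀ x ∈ A' ++ [z], x ∈ c₁ :: (A' ++ [z]) ++ c₂ :: b :: B' := fun x hx =>
      List.mem_append_left _ (List.mem_cons_of_mem _ hx)
    have hsubB : ∀ x ∈ b :: B', x ∈ c₁ :: (A' ++ [z]) ++ c₂ :: b :: B' := fun x hx =>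
      List.mem_append_right _ (List.mem_cons_of_mem _ hx)
    have hdis : ∀ x ∈ A' ++ [z], x ∉ b :: B' := by
      intro x hx hx'
      exact (List.nodup_append.1 h.nodup).2.2 x (List.mem_cons_of_mem _ hx) x
        (List.mem_cons_of_mem _ hx') rfl
    rcases hy with hy | hy <;> rcases hy' with hy' | hy'
    · exact h.not_mem y (hsubA _ hy') (hsubA _ hy)
    · exact hdis _ hy hy'
    · exact hdis _ hy' hy
    · exact h.not_mem y (hsubB _ hy) (hsubB _ hy')
  have hnodup : L'.Nodup := by
    have hn := h.nodup
    rw [List.nodup_append] at hn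
    refine List.nodup_append.2 ⟨?_, (List.nodup_cons.1 hn.2.1).2, ?_⟩
    · refine List.Nodup.map (fun x y hxy => P.rot.injective (P.rot.injective hxy)) ?_
      exact List.nodup_reverse.2 (List.nodup_cons.1 hn.1).2
    · rintro x hx y hy rfl
      obtain ⟨w, hw, rfl⟩ := List.mem_map.1 hx
      exact h.not_mem w (List.mem_append_left _ (List.mem_cons_of_mem _ (List.mem_reverse.1 hw)))
        (List.mem_append_right _ (List.mem_cons_of_mem _ hy))
  have hch : Cycle.Chain (fun x y => F (P.opp x) = y) (L' : Cycle P.Dart) := by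
    have h1 := isChain_backward (f := F) hchA' fun x hx => hF2 x (hcA x hx)
    have h2 : F c₁ = b := by rw [hF1 _ hc1, hσ1, hb]
    have h3 : F (P.rot (P.rot c₁)) = P.rot (P.rot z) := by
      rw [hF1 _ ((hrr _).2 hc1), hσ1', ahead, opp_rot_rot_of_ahead_eq hz]
    have h4 := isChain_forward (f := F) hchB' (fun x hx => by
      rw [hF2 _ (mt (hrr x).1 (hcB x (List.mem_cons_of_mem _ hx))), P.rot_four]) h3
    rw [h2, List.reverse_append, List.reverse_singleton, List.singleton_append, List.map_cons] at h1
    rw [hL', List.reverse_append, List.reverse_singleton, List.singleton_append, List.map_cons,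
      List.cons_append, Cycle.chain_coe_cons, List.append_assoc, List.cons_append,
      ← List.cons_append, List.isChain_split]
    exact ⟨h1, h4⟩
  -- the tour of all edges after the splice, with the darts of the crossing still in place
  have hchP : Cycle.Chain (fun x y => P.spliceTurn c (P.opp x) = y)
      ((c₂ :: (b :: B' ++ P.rot (P.rot c₂) ::
        (A' ++ [z]).reverse.map (fun x => P.rot (P.rot x))) : List P.Dart) : Cycle P.Dart) := by
    have h1 := isChain_backward (f := P.spliceTurn c) hchA' fun x hx =>
      spliceTurn_of_not c (hcA x hx)
    have h4 := isChain_forward (f := P.spliceTurn c) hchB (fun x hx => by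
      rw [spliceTurn_of_not _ (mt (hrr x).1 (hcB x hx)), P.rot_four]) hσ1'
    rw [Cycle.chain_coe_cons, List.append_assoc]
    change ((c₂ :: b :: B') ++ P.rot (P.rot c₂) ::
      ((A' ++ [z]).reverse.map (fun x => P.rot (P.rot x)) ++ [c₂])).IsChain _
    rw [List.isChain_split]
    refine ⟨h4, ?_⟩
    rw [hσ1, List.reverse_append, List.reverse_singleton, List.singleton_append, List.map_cons] at h1
    rw [List.reverse_append, List.reverse_singleton, List.singleton_append, List.map_cons,
      List.cons_append, List.isChain_cons_cons]
    refine ⟨?_, h1⟩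
    rw [opp_rot_rot_of_ahead_eq hz, spliceTurn_of_not c (hcA z (by simp))]
  obtain ⟨L'', hL''⟩ : ∃ L'' : List {x : P.Dart // ¬ P.AtCrossing c x},
      L''.map Subtype.val = L' := ⟨L'.attachWith _ hL'c, by simp⟩
  have hmem'' : ∀ y : {x : P.Dart // ¬ P.AtCrossing c x}, y ∈ L'' ↔ (y : P.Dart) ∈ L' := by
    intro y
    rw [← hL'', List.mem_map_of_injective Subtype.val_injective]
  have hch'' : Cycle.Chain
      (fun x y => P.splicedRot c (P.splicedRot c (P.splicedOpp c hP x)) = y)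
      (L'' : Cycle {x : P.Dart // ¬ P.AtCrossing c x}) := by
    rw [← hL'', ← Cycle.map_coe, Cycle.chain_map] at hch
    refine hch.imp fun x y hxy => Subtype.ext ?_
    rw [← hxy, hFopp]
    rfl
  have hor'' : ∀ y : {x : P.Dart // ¬ P.AtCrossing c x},
      y ∈ L'' ∨ P.splicedRot c (P.splicedRot c y) ∈ L'' := fun y =>
    (hor y y.2).imp (hmem'' _).2 (hmem'' _).2
  have hκ'' : ∀ x y : {x : P.Dart // ¬ P.AtCrossing c x},
      κ x = κ y ↔ (P.splicedRot c).SameCycle x y := by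
    intro x y
    rw [hκ, splicedRot, Equiv.Perm.sameCycle_subtypePerm]
  have hword : ((A' ++ [z]).map κ).reverse ++ (b :: B').map κ = L''.map fun x => κ x.1 := by
    have : L''.map (fun x => κ x.1) = L'.map κ := by rw [← hL'', List.map_map]; rfl
    rw [this, hL', List.map_append (l₁ := List.map _ _), List.map_map, ← List.map_reverse]
    congr 1
    refine List.map_congr_left fun x _ => ?_
    exact (hκ _ _).2 (by simp [Equiv.Perm.SameCycle.refl])
  refine ⟨spliced hP c ?_, fun x => κ x.1, ⟨c, ?_, Equiv.refl _, fun x => rfl, fun x => ?_⟩,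
    ?_, L'', ⟨hch'', ?_, ?_, ?_⟩, ?_⟩
  · exact exists_iterate_eq_or_of_chain (opp := P.splicedOpp c hP)
      (turn := fun x => P.splicedRot c (P.splicedRot c x))
      (fun x => Subtype.ext (spliceOpp_spliceOpp c x.2))
      (fun x => Subtype.ext (P.rot_four x)) hch'' hor''
  · refine exists_iterate_eq_or_of_chain P.opp_opp (spliceTurn_spliceTurn c) hchP fun y => ?_
    by_cases hy : P.AtCrossing c y
    · have : y = c₁ ∨ y = c₂ ∨ y = P.rot (P.rot c₁) ∨ y = P.rot (P.rot c₂) := by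
        have hy' : P.AtCrossing c₁ y :=
          Equiv.Perm.SameCycle.trans (Equiv.Perm.SameCycle.symm hc1) hy
        rcases h.eq_rot_or_eq_rot hc12 with h1 | h1
        · rw [h1]
          have := atCrossing_iff.1 hy'
          tauto
        · have := atCrossing_iff.1 (Equiv.Perm.SameCycle.trans (Equiv.Perm.SameCycle.symm hc12) hy')
          rw [h1]
          tauto
      rcases this with rfl | rfl | rfl | rfl
      · exact Or.inr (by simp [hσ1])
      · exact Or.inl (by simp)
      · exact Or.inr (by simp [hσ1'])
      · exact Or.inl (by simp)
    · rw [spliceTurn_of_not c hy]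
      have hsub : ∀ x ∈ L', x ∈ c₂ :: (b :: B' ++ P.rot (P.rot c₂) ::
          (A' ++ [z]).reverse.map (fun x => P.rot (P.rot x))) := by
        intro x hx
        rcases List.mem_append.1 hx with hx | hx
        · exact List.mem_cons_of_mem _ (List.mem_append_right _ (List.mem_cons_of_mem _ hx))
        · exact List.mem_cons_of_mem _ (List.mem_append_left _ hx)
      exact (hor y hy).imp (hsub _) (hsub _)
  · change ∃ k : ℕ, P.spliceOpp c x.1 = (fun d => P.opp (P.spliceTurn c d))^[k] (P.opp x.1) ∧
      ∀ j < k, P.AtCrossing c ((fun d => P.opp (P.spliceTurn c d))^[j] (P.opp x.1))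
    by_cases hx : P.AtCrossing c (P.opp x.1)
    · exact ⟨1, spliceOpp_of_atCrossing c hx, fun j hj => by
        rw [Nat.lt_one_iff.1 hj]
        exact hx⟩
    · exact ⟨0, spliceOpp_of_not c hx, fun j hj => absurd hj (Nat.not_lt_zero j)⟩
  · exact hκ''
  · exact List.Nodup.of_map Subtype.val (hL''.symm ▸ hnodup)
  · exact hor''
  · intro y hy hy'
    exact hnot y.1 ((hmem'' y).1 hy) ((hmem'' _).1 hy')
  · exact hword

/-- A curve with a Gauss word that `k` splices untangle has reductivity at most `k`. -/
theorem IsGaussWord.exists_spliceSteps {α : Type} {κ : P.Dart → α} {w : List α} {k : ℕ}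
    (h : P.IsGaussWord κ w) (hw : Untangles k w) :
    ∃ j ≤ k, ∃ Q : SphericalCurve, SpliceSteps j P Q ∧ Q.Reducible := by
  induction hw generalizing P with
  | of_isRotated_isolated x A B hr hAB =>
    obtain ⟨c₁, c₂, A', B', hL, hcc, rfl, rfl⟩ := h.exists_tour hr
    refine ⟨0, Nat.zero_le _, P, .refl P, hL.reducible ((h.1 _ _).1 hcc) fun x hx y hy hxy => ?_⟩
    refine hAB (List.mem_map_of_mem hx) ?_
    rw [(h.1 x y).2 hxy]
    exact List.mem_map_of_mem hy
  | of_isRotated_splice x A B hr _ ih =>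
    by_cases hP : P.Reducible
    · exact ⟨0, Nat.zero_le _, P, .refl P, hP⟩
    obtain ⟨c₁, c₂, A', B', hL, hcc, rfl, rfl⟩ := h.exists_tour hr
    obtain ⟨Q, κ', hPQ, hQ⟩ := hL.exists_splice hP h.1 hcc
    obtain ⟨j, hj, R, hQR, hR⟩ := ih hQ
    exact ⟨j + 1, Nat.succ_le_succ hj, R, .step hPQ hQR, hR⟩

theorem reductivity_le_of_untangles {α : Type} {κ : P.Dart → α} {w : List α} {k : ℕ}
    (h : P.IsGaussWord κ w) (hw : Untangles k w) : P.reductivity ≤ k := by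
  obtain ⟨j, hj, Q, hQ⟩ := h.exists_spliceSteps hw
  exact (iInf₂_le j ⟨Q, hQ⟩).trans (by exact_mod_cast hj)

theorem reductivity_of_reducible (h : P.Reducible) : P.reductivity = 0 :=
  nonpos_iff_eq_zero.1 (iInf₂_le 0 ⟨P, .refl P, h⟩)

end SphericalCurve

/-! ### Positions along a tour -/

namespace SphericalCurve

variable {P : SphericalCurve}

/-- The crossing from which a dart points away. -/
def crossing (P : SphericalCurve) (d : P.Dart) : Quotient (Equiv.Perm.SameCycle.setoid P.rot) :=
  Quotient.mk _ d

theorem crossing_eq_iff {x y : P.Dart} : P.crossing x = P.crossing y ↔ P.AtCrossing x y :=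
  ⟨fun h => Quotient.exact h, fun h => Quotient.sound h⟩

theorem crossing_face (d : P.Dart) : P.crossing (P.face d) = P.crossing (P.opp d) :=
  (crossing_eq_iff.2 (sameCycle_rot_face d)).symm

theorem crossing_ahead (d : P.Dart) : P.crossing (P.ahead d) = P.crossing (P.face d) := by
  rw [crossing_face]
  exact (crossing_eq_iff.2 (sameCycle_rot_ahead d)).symm

theorem crossing_ahead_opp (d : P.Dart) : P.crossing (P.ahead (P.opp d)) = P.crossing d := by
  rw [crossing_ahead, crossing_face, P.opp_opp]

theorem crossing_face_ne (hP : ¬ P.Reducible) (d : P.Dart) :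
    P.crossing (P.face d) ≠ P.crossing d := fun h =>
  not_atCrossing_opp hP d (crossing_eq_iff.1 (h.symm.trans (crossing_face d)))

/-- The number of edges passed in one tour. -/
noncomputable def tourLength (P : SphericalCurve) (x : P.Dart) : ℕ :=
  Function.minimalPeriod P.ahead x

/-- The crossings passed at the times `s, …, e - 1` after the start at `x`. -/
def stretch (P : SphericalCurve) (x : P.Dart) (s e : ℕ) :
    List (Quotient (Equiv.Perm.SameCycle.setoid P.rot)) :=
  (List.Ico s e).map fun i => P.crossing (P.ahead^[i] x)

theorem isGaussWord_stretch (x : P.Dart) :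
    P.IsGaussWord P.crossing (P.stretch x 0 (P.tourLength x)) := by
  refine ⟨fun x y => crossing_eq_iff, _, isTour_range x, ?_⟩
  rw [List.map_map, stretch, List.Ico.zero_bot]
  rfl

theorem stretch_append (x : P.Dart) {s m e : ℕ} (h1 : s ≤ m) (h2 : m ≤ e) :
    P.stretch x s e = P.stretch x s m ++ P.stretch x m e := by
  rw [stretch, stretch, stretch, ← List.map_append, List.Ico.append_consecutive h1 h2]

theorem stretch_cons (x : P.Dart) {s e : ℕ} (h : s < e) :
    P.stretch x s e = P.crossing (P.ahead^[s] x) :: P.stretch x (s + 1) e := by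
  rw [stretch, List.Ico.eq_cons h, List.map_cons, stretch]

theorem stretch_edge {x f : P.Dart} {s e : ℕ} (h : s + 2 ≤ e) (hf : P.ahead^[s] x = f) :
    P.stretch x s e = P.crossing f :: P.crossing (P.ahead f) :: P.stretch x (s + 2) e := by
  rw [stretch_cons x (by omega), stretch_cons x (by omega), Function.iterate_succ_apply', hf]

theorem iterate_tourLength (x : P.Dart) : P.ahead^[P.tourLength x] x = x :=
  Function.iterate_minimalPeriod

theorem iterate_ahead_inj {x : P.Dart} {i j : ℕ} (hi : i < P.tourLength x)
    (hj : j < P.tourLength x) (h : P.ahead^[i] x = P.ahead^[j] x) : i = j :=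
  (Function.iterate_eq_iterate_iff_of_lt_minimalPeriod hi hj).1 h

theorem exists_time {x y : P.Dart} (h : P.aheadPerm.SameCycle x y) :
    ∃ i < P.tourLength x, P.ahead^[i] x = y :=
  Equiv.Perm.sameCycle_iff_exists_lt.1 h

theorem sameCycle_iterate (x : P.Dart) (i : ℕ) : P.aheadPerm.SameCycle x (P.ahead^[i] x) := by
  rw [← coe_aheadPerm, ← Equiv.Perm.coe_pow]
  exact Equiv.Perm.sameCycle_pow_right.2 (.refl _ _)

theorem tourLength_eq {x y : P.Dart} (h : P.aheadPerm.SameCycle x y) :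
    P.tourLength x = P.tourLength y := h.minimalPeriod_eq

theorem ahead_of_time_succ_eq {x f g : P.Dart} {i j : ℕ} (hi : P.ahead^[i] x = f)
    (hj : P.ahead^[j] x = g) (h : i + 1 = j) : P.ahead f = g := by
  rw [← hi, ← hj, ← h, Function.iterate_succ_apply']

theorem ahead_of_time_succ_eq_tourLength {x f : P.Dart} {i : ℕ} (hi : P.ahead^[i] x = f)
    (h : i + 1 = P.tourLength x) : P.ahead f = x := by
  have hx := iterate_tourLength x
  rwa [← h, Function.iterate_succ_apply', hi] at hx

/-- A tour is at the same crossing only twice. -/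
theorem crossing_iterate_ne {x : P.Dart} {i j k : ℕ} (hi : i < P.tourLength x)
    (hj : j < P.tourLength x) (hk : k < P.tourLength x) (hij : i ≠ j) (hik : i ≠ k) (hjk : j ≠ k)
    (h : P.crossing (P.ahead^[i] x) = P.crossing (P.ahead^[j] x)) :
    P.crossing (P.ahead^[i] x) ≠ P.crossing (P.ahead^[k] x) := by
  intro h'
  have hmem : ∀ l < P.tourLength x, P.ahead^[l] x ∈
      (List.range (Function.minimalPeriod P.ahead x)).map fun n => P.ahead^[n] x := fun l hl =>
    List.mem_map.2 ⟨l, List.mem_range.2 hl, rfl⟩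
  rcases (isTour_range x).eq_or_eq_or_eq (hmem i hi) (hmem j hj) (hmem k hk)
    (crossing_eq_iff.1 h) (crossing_eq_iff.1 h') with h1 | h1 | h1
  · exact hij (iterate_ahead_inj hi hj h1)
  · exact hik (iterate_ahead_inj hi hk h1)
  · exact hjk (iterate_ahead_inj hj hk h1)

theorem stretch_two_edges {x f : P.Dart} {s : ℕ} (hs : 0 < s) (hsN : s < P.tourLength x)
    (hf : P.ahead^[s] x = f) (h1 : P.ahead x ≠ f) (h2 : P.ahead f ≠ x) :
    P.stretch x 0 (P.tourLength x) = P.crossing x :: P.crossing (P.ahead x) :: (P.stretch x 2 s ++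
      P.crossing f :: P.crossing (P.ahead f) :: P.stretch x (s + 2) (P.tourLength x)) := by
  have h3 : 0 + 1 ≠ s := fun h => h1 (ahead_of_time_succ_eq (x := x) rfl hf h)
  have h4 : s + 1 ≠ P.tourLength x := fun h => h2 (ahead_of_time_succ_eq_tourLength hf h)
  rw [stretch_edge (x := x) (f := x) (by omega) rfl, stretch_append x (m := s) (by omega) (by omega),
    stretch_edge (by omega) hf]

theorem stretch_three_edges {x f g : P.Dart} {s t : ℕ} (hs : 0 < s) (hst : s < t)
    (htN : t < P.tourLength x) (hf : P.ahead^[s] x = f) (hg : P.ahead^[t] x = g)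
    (h1 : P.ahead x ≠ f) (h2 : P.ahead f ≠ g) (h3 : P.ahead g ≠ x) :
    P.stretch x 0 (P.tourLength x) = P.crossing x :: P.crossing (P.ahead x) :: (P.stretch x 2 s ++
      P.crossing f :: P.crossing (P.ahead f) :: (P.stretch x (s + 2) t ++
      P.crossing g :: P.crossing (P.ahead g) :: P.stretch x (t + 2) (P.tourLength x))) := by
  have h4 : 0 + 1 ≠ s := fun h => h1 (ahead_of_time_succ_eq (x := x) rfl hf h)
  have h5 : s + 1 ≠ t := fun h => h2 (ahead_of_time_succ_eq hf hg h)
  have h6 : t + 1 ≠ P.tourLength x := fun h => h3 (ahead_of_time_succ_eq_tourLength hg h)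
  rw [stretch_edge (x := x) (f := x) (by omega) rfl, stretch_append x (m := s) (by omega) (by omega),
    stretch_edge (by omega) hf, stretch_append x (s := s + 2) (m := t) (by omega) (by omega),
    stretch_edge (by omega) hg]

/-! ### 1-gons, 2-gons and 3-gons -/

/-- Curves of reductivity four in the form in which it is used: neither the curve is reducible nor
do three splices make it so. -/
structure Tangled (P : SphericalCurve) : Prop where
  not_reducible : ¬ P.Reducible
  not_untangles : ∀ x : P.Dart, ¬ Untangles 3 (P.stretch x 0 (P.tourLength x))

theorem tangled_of_reductivity (h : P.reductivity = 4) : P.Tangled where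
  not_reducible hP := by
    rw [reductivity_of_reducible hP] at h
    exact absurd h (by norm_num)
  not_untangles x hx := by
    have := reductivity_le_of_untangles (isGaussWord_stretch x) hx
    rw [h] at this
    exact absurd this (by decide)

theorem minimalPeriod_face_ne_one (hP : P.Tangled) (d : P.Dart) :
    Function.minimalPeriod P.face d ≠ 1 := fun h =>
  crossing_face_ne hP.not_reducible d
    (congrArg P.crossing (Function.minimalPeriod_eq_one_iff_isFixedPt.1 h))

theorem minimalPeriod_face_ne_two (hP : P.Tangled) (d : P.Dart) :
    Function.minimalPeriod P.face d ≠ 2 := by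
  intro h
  classical
  have hne := crossing_face_ne hP.not_reducible
  obtain ⟨e, he⟩ : ∃ e, e = P.face d := ⟨_, rfl⟩
  have hd : P.face e = d := by
    have := Function.iterate_minimalPeriod (f := P.face) (x := d)
    rw [h] at this
    rw [he]
    exact this
  have hpq : P.crossing e ≠ P.crossing d := he ▸ hne d
  have h1 : P.crossing (P.ahead d) = P.crossing e := by rw [crossing_ahead, he]
  have hcount := (isGaussWord_stretch d).count_le_two
  rcases P.sameCycle_ahead_or d e with hs | hs
  · obtain ⟨s, hsN, hse⟩ := exists_time hs
    have h0 : 0 < s := Nat.pos_of_ne_zero (by rintro rfl; exact hpq (congrArg P.crossing hse.symm))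
    have hw := stretch_two_edges h0 hsN hse (he ▸ ahead_ne_face d)
      (fun h => ahead_ne_face e (h.trans hd.symm))
    rw [h1, crossing_ahead e, hd] at hw
    refine hP.not_untangles d ?_
    rw [hw] at hcount ⊢
    exact (Untangles.bigon_opposite _ _ _ _ hcount).mono (by norm_num)
  · obtain ⟨s, hsN, hse⟩ := exists_time hs
    have h2 : P.crossing (P.opp e) = P.crossing d := by rw [← crossing_face, hd]
    have h3 := crossing_ahead_opp e
    have h0 : 0 < s := Nat.pos_of_ne_zero (by
      rintro rfl
      have hde : d = P.opp e := hse
      have hrot := P.rot_face d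
      rw [← he, hde, P.opp_opp] at hrot
      exact P.rot_ne e hrot)
    have hw := stretch_two_edges h0 hsN hse (fun h => hpq (by rw [← h1, h, h2]))
      (fun h => hpq (by rw [← h3, h]))
    rw [h1, h2, h3] at hw
    refine hP.not_untangles d ?_
    rw [hw]
    exact (Untangles.bigon_same _ _ _ _).mono (by norm_num)

theorem triangle_incoherent_false (hP : P.Tangled) {d e f : P.Dart} (he : P.face d = e)
    (hf : P.face e = f) (hd : P.face f = d) (h1 : P.aheadPerm.SameCycle d e)
    (h2 : P.aheadPerm.SameCycle d (P.opp f)) : False := by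
  classical
  have hne := crossing_face_ne hP.not_reducible
  have h01 : P.crossing e ≠ P.crossing d := he ▸ hne d
  have h12 : P.crossing f ≠ P.crossing e := hf ▸ hne e
  have h20 : P.crossing d ≠ P.crossing f := hd ▸ hne f
  have hcd : P.crossing (P.ahead d) = P.crossing e := by rw [crossing_ahead, he]
  have hce : P.crossing (P.ahead e) = P.crossing f := by rw [crossing_ahead, hf]
  have hcf : P.crossing (P.opp f) = P.crossing d := by rw [← crossing_face, hd]
  have hcf' := crossing_ahead_opp f
  obtain ⟨s, hsN, hs⟩ := exists_time h1
  obtain ⟨t, htN, ht⟩ := exists_time h2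
  have hs0 : 0 < s := Nat.pos_of_ne_zero (by rintro rfl; exact h01 (congrArg P.crossing hs.symm))
  have ht0 : 0 < t := Nat.pos_of_ne_zero (by
    rintro rfl
    have hdf : d = P.opp f := ht
    rw [← hdf, hcd] at hcf'
    exact h12 hcf'.symm)
  have hst : s ≠ t := by
    rintro rfl
    exact h01 ((congrArg P.crossing (hs.symm.trans ht)).trans hcf)
  have hcount := (isGaussWord_stretch d).count_le_two
  refine hP.not_untangles d ?_
  rcases lt_or_gt_of_ne hst with hst | hst
  · have hw := stretch_three_edges hs0 hst htN hs ht (he ▸ ahead_ne_face d)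
      (fun h => h20 (by rw [← hcf, ← h, hce])) (fun h => h20 (by rw [← hcf', h]))
    rw [hcd, hce, hcf, hcf'] at hw
    rw [hw] at hcount ⊢
    exact Untangles.triangle_incoherent' _ _ _ _ _ _ hcount
  · have hw := stretch_three_edges ht0 hst hsN ht hs (fun h => h01 (by rw [← hcd, h, hcf]))
      (fun h => h12 (by rw [← hcf', h])) (fun h => h20 (by rw [← hce, h]))
    rw [hcd, hce, hcf, hcf'] at hw
    rw [hw]
    exact (Untangles.triangle_incoherent _ _ _ _ _ _).mono (by norm_num)

/-- Every 3-gon of a curve of reductivity four is of type D. -/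
theorem isTypeD_of_isGon (hP : P.Tangled) {d : P.Dart} (h : P.IsGon 3 d) : P.IsTypeD d := by
  refine ⟨h, ?_⟩
  obtain ⟨e, he⟩ : ∃ e, P.face d = e := ⟨_, rfl⟩
  obtain ⟨f, hf⟩ : ∃ f, P.face e = f := ⟨_, rfl⟩
  have hd : P.face f = d := by
    have := Function.iterate_minimalPeriod (f := P.face) (x := d)
    rw [h] at this
    rw [← hf, ← he]
    exact this
  have hne := crossing_face_ne hP.not_reducible
  have h01 : P.crossing e ≠ P.crossing d := he ▸ hne d
  have h12 : P.crossing f ≠ P.crossing e := hf ▸ hne e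
  have h20 : P.crossing d ≠ P.crossing f := hd ▸ hne f
  have hcd : P.crossing (P.ahead d) = P.crossing e := by rw [crossing_ahead, he]
  have hce : P.crossing (P.ahead e) = P.crossing f := by rw [crossing_ahead, hf]
  have hcf : P.crossing (P.ahead f) = P.crossing d := by rw [crossing_ahead, hd]
  -- unless the sides are coherently oriented, the incoherent case applies to a rotation of the
  -- 3-gon, possibly after reversal of the curve
  rcases P.sameCycle_ahead_or d e with h1 | h1 <;> rcases P.sameCycle_ahead_or d f with h2 | h2
  · obtain ⟨s, hsN, hs⟩ := exists_time h1
    obtain ⟨t, htN, ht⟩ := exists_time h2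
    have hs0 : 0 < s := Nat.pos_of_ne_zero (by rintro rfl; exact h01 (congrArg P.crossing hs.symm))
    have ht0 : 0 < t := Nat.pos_of_ne_zero (by rintro rfl; exact h20 (congrArg P.crossing ht))
    have hst : s ≠ t := by
      rintro rfl
      exact h12 (congrArg P.crossing (ht.symm.trans hs))
    rcases lt_or_gt_of_ne hst with hst | hst
    · refine ⟨d, ![0, s, t], ?_, ?_, ?_⟩
      · rw [Fin.strictMono_iff_lt_succ]
        intro i
        fin_cases i
        · exact hs0
        · exact hst
      · intro j
        fin_cases j
        · exact hs0.trans hsN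
        · exact hsN
        · exact htN
      · intro j
        fin_cases j
        · rfl
        · exact hs.trans he.symm
        · exact ht.trans (by rw [← hf, ← he]; rfl)
    · refine absurd ?_ (hP.not_untangles d)
      have hw := stretch_three_edges ht0 hst hsN ht hs (fun h => h12 (by rw [← hcd, h]))
        (fun h => h01 (by rw [← hcf, h])) (fun h => h20 (by rw [← hce, h]))
      rw [hcd, hce, hcf] at hw
      rw [hw]
      exact Untangles.triangle_coherent _ _ _ _ _ _
  · exact (triangle_incoherent_false hP he hf hd h1 h2).elim
  · exact (triangle_incoherent_false hP hd he hf h2.symm (h2.symm.trans h1)).elim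
  · refine (triangle_incoherent_false hP hf hd he ?_ ?_).elim
    · have := sameCycle_ahead_opp (h1.symm.trans h2)
      rwa [P.opp_opp, P.opp_opp] at this
    · have := sameCycle_ahead_opp h1.symm
      rwa [P.opp_opp] at this

end SphericalCurve

/-! ### Mirror images -/

namespace SphericalCurve

variable {P : SphericalCurve}

theorem minimalPeriod_eq_of_conj_symm {X : Type} [Finite X] {f : Equiv.Perm X} {g φ : X → X}
    (hφ : Function.Injective φ) (h : ∀ z, g (φ z) = φ (f.symm z)) (z : X) :
    Function.minimalPeriod g (φ z) = Function.minimalPeriod f z := by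
  have hiter : ∀ n z, g^[n] (φ z) = φ (f.symm^[n] z) := by
    intro n
    induction n with
    | zero => intro z; rfl
    | succ n ih => intro z; rw [Function.iterate_succ_apply, h, ih, Function.iterate_succ_apply]
  rw [Function.minimalPeriod_eq_minimalPeriod_iff]
  intro n
  have hinv : Function.LeftInverse f.symm^[n] f^[n] := f.left_inv.iterate n
  constructor
  · intro hn
    have h1 : f.symm^[n] z = z := hφ ((hiter n z).symm.trans hn)
    have h2 : f.symm^[n] (f^[n] z) = f.symm^[n] z := (hinv z).trans h1.symm
    exact (f.symm.injective.iterate n) h2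
  · intro hn
    have h1 : f.symm^[n] z = z := by
      have := hinv z
      rwa [show f^[n] z = z from hn] at this
    exact (hiter n z).trans (congrArg φ h1)

theorem iterate_ahead_opp (x : P.Dart) {i m : ℕ} (h : i ≤ m) :
    P.ahead^[m - i] (P.opp (P.ahead^[m] x)) = P.opp (P.ahead^[i] x) := by
  obtain ⟨k, rfl⟩ := Nat.exists_eq_add_of_le h
  rw [Nat.add_sub_cancel_left]
  clear h
  induction k with
  | zero => rfl
  | succ k ih =>
    rw [← add_assoc, Function.iterate_succ_apply' P.ahead (i + k), Function.iterate_succ_apply,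
      ahead_opp_ahead, ih]

theorem tourLength_opp (x : P.Dart) : P.tourLength (P.opp x) = P.tourLength x := by
  refine minimalPeriod_eq_of_conj_symm (f := P.aheadPerm) P.opp.injective (fun z => ?_) x
  obtain ⟨y, rfl⟩ := P.aheadPerm.surjective z
  rw [Equiv.symm_apply_apply, aheadPerm_apply, ahead_opp_ahead]

/-- The mirror image of a spherical curve, with the same darts. -/
def mirror (P : SphericalCurve) : SphericalCurve where
  Dart := P.Dart
  finite := P.finite
  opp := P.opp
  rot := P.rot.symm
  opp_opp := P.opp_opp
  opp_ne := P.opp_ne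
  rot_four d := by simp only [rot_symm, P.rot_four]
  rot_two_ne d := by
    simp only [rot_symm, P.rot_four]
    exact P.rot_two_ne d
  single x y := by
    simp only [rot_symm, P.rot_four]
    exact P.single x y
  euler := by
    have h1 : 4 * numCycles P.rot.symm = Nat.card P.Dart :=
      mul_numCycles_of_minimalPeriod _ fun x => minimalPeriod_eq_four
        (by simp only [rot_symm, P.rot_four])
        (by simp only [rot_symm, P.rot_four]; exact P.rot_two_ne x)
    have h2 := P.four_mul_numCycles_rot
    have h3 : numCycles (P.opp.trans P.rot.symm.symm) = numCycles P.face := by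
      have := Fintype.ofFinite P.Dart
      have hq : (numCycles (P.opp.trans P.rot.symm.symm) : ℚ) = numCycles P.face := by
        rw [numCycles_eq_sum, numCycles_eq_sum, ← Equiv.sum_comp P.opp]
        refine Finset.sum_congr rfl fun z _ => ?_
        rw [minimalPeriod_eq_of_conj_symm (f := P.face) P.opp.injective fun z => ?_]
        obtain ⟨y, rfl⟩ := P.face.surjective z
        rw [Equiv.symm_apply_apply]
        change P.rot (P.opp (P.opp (P.face y))) = P.opp y
        rw [P.opp_opp, P.rot_face]
      exact_mod_cast hq
    have h4 : numCycles P.rot + numCycles P.face = numCycles P.opp + 2 := P.euler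
    omega

theorem isMirror_mirror (P : SphericalCurve) : P.IsMirror P.mirror :=
  ⟨Equiv.refl _, fun _ => rfl, fun _ => rfl⟩

theorem ahead_mirror : P.mirror.ahead = P.ahead := by
  funext d
  change P.rot.symm (P.rot.symm (P.opp d)) = P.rot (P.rot (P.opp d))
  simp only [rot_symm, P.rot_four]

theorem face_mirror_opp (d : P.Dart) : P.mirror.face (P.opp (P.face d)) = P.opp d := by
  change P.rot (P.opp (P.opp (P.face d))) = P.opp d
  rw [P.opp_opp, P.rot_face]

theorem isGon_mirror_opp {n : ℕ} (d : P.Dart) : P.mirror.IsGon n (P.opp d) ↔ P.IsGon n d := by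
  have : Function.minimalPeriod P.mirror.face (P.opp d) = Function.minimalPeriod P.face d := by
    refine minimalPeriod_eq_of_conj_symm (f := P.face) P.opp.injective (fun z => ?_) d
    obtain ⟨y, rfl⟩ := P.face.surjective z
    rw [Equiv.symm_apply_apply, face_mirror_opp]
  unfold IsGon
  rw [this]

/-! ### 4-gons that share a side with a 3-gon of type D -/

/-- The same three passages, with the time counted from the second one. -/
theorem times_rotate {x y z : P.Dart} {i j : ℕ} (hi : 0 < i) (hij : i < j)
    (hj : j < P.tourLength x) (hy : P.ahead^[i] x = y) (hz : P.ahead^[j] x = z) :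
    ∃ k l, 0 < k ∧ k < l ∧ l < P.tourLength y ∧ P.ahead^[k] y = z ∧ P.ahead^[l] y = x := by
  have hN : P.tourLength x = P.tourLength y := tourLength_eq (hy ▸ P.sameCycle_iterate x i)
  refine ⟨j - i, P.tourLength x - i, by omega, by omega, by omega, ?_, ?_⟩
  · rw [← hy, ← Function.iterate_add_apply, Nat.sub_add_cancel hij.le, hz]
  · rw [← hy, ← Function.iterate_add_apply, Nat.sub_add_cancel (by omega), iterate_tourLength]

theorem IsTypeD.exists_times {d : P.Dart} (h : P.IsTypeD d) :
    ∃ i j, 0 < i ∧ i < j ∧ j < P.tourLength d ∧ P.ahead^[i] d = P.face d ∧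
      P.ahead^[j] d = P.face (P.face d) := by
  obtain ⟨-, x, t, ht, htN, hx⟩ := h
  have h0 : P.ahead^[t 0] x = d := hx 0
  have h1 : P.ahead^[t 1] x = P.face d := hx 1
  have h2 : P.ahead^[t 2] x = P.face (P.face d) := hx 2
  have h01 : t 0 < t 1 := ht (by decide)
  have h12 : t 1 < t 2 := ht (by decide)
  have hN : P.tourLength x = P.tourLength d := tourLength_eq (h0 ▸ P.sameCycle_iterate x _)
  have h2N : t 2 < P.tourLength x := htN 2
  refine ⟨t 1 - t 0, t 2 - t 0, by omega, by omega, by omega, ?_, ?_⟩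
  · conv_lhs => rw [← h0, ← Function.iterate_add_apply, Nat.sub_add_cancel h01.le, h1]
  · conv_lhs => rw [← h0, ← Function.iterate_add_apply, Nat.sub_add_cancel (h01.trans h12).le, h2]

theorem ahead_eq_face_opp_face (d : P.Dart) : P.ahead d = P.face (P.opp (P.face d)) := by
  rw [face_apply (P.opp _), P.opp_opp, ahead, ← P.rot_face]

theorem face_iterate_three {d : P.Dart} (h : P.IsGon 3 d) : P.face (P.face (P.face d)) = d := by
  have := Function.iterate_minimalPeriod (f := P.face) (x := d)
  rw [h] at this
  exact this

theorem face_iterate_four {d : P.Dart} (h : P.IsGon 4 d) :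
    P.face (P.face (P.face (P.face d))) = d := by
  have := Function.iterate_minimalPeriod (f := P.face) (x := d)
  rw [h] at this
  exact this

/-- A 4-gon with sides `a`, `b`, `c`, `d` and a 3-gon of type D that share the side `d`. The
branches of `a` and `c` run along the other two sides of the 3-gon, so `a` and `c` are passed
against the direction of `d`, and the positions `1`, `u`, `v` of `a`, `d`, `c` in the tour that
starts at the side of the 3-gon before `a` are in this order. -/
structure FourGonTimes (P : SphericalCurve) (x a b c d : P.Dart) (u v : ℕ) : Prop where
  face_a : P.face a = b
  face_b : P.face b = c
  face_c : P.face c = d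
  face_d : P.face d = a
  le_u : 3 ≤ u
  u_le : u + 2 ≤ v
  v_le : v + 3 ≤ P.tourLength x
  time_a : P.ahead x = a
  time_d : P.ahead^[u] x = P.opp d
  time_c : P.ahead^[v] x = c
  crossing_x : P.crossing (P.ahead (P.ahead c)) = P.crossing x

theorem exists_fourGonTimes (hP : P.Tangled) {a : P.Dart} (h4 : P.IsGon 4 a)
    (hD : P.IsTypeD (P.side a 3 false)) :
    ∃ x b c d u v, P.FourGonTimes x a b c d u v := by
  obtain ⟨b, hb⟩ : ∃ b, P.face a = b := ⟨_, rfl⟩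
  obtain ⟨c, hc⟩ : ∃ c, P.face b = c := ⟨_, rfl⟩
  obtain ⟨d, hd⟩ : ∃ d, P.face c = d := ⟨_, rfl⟩
  have ha : P.face d = a := by rw [← hd, ← hc, ← hb, face_iterate_four h4]
  have hside : P.side a 3 false = P.opp d := by
    change P.opp (P.face (P.face (P.face a))) = _
    rw [hb, hc, hd]
  rw [hside] at hD
  obtain ⟨i, j, hi, hij, hj, h1, h2⟩ := hD.exists_times
  obtain ⟨i', j', hi', hij', hj', h1', h2'⟩ := times_rotate hi hij hj h1 h2
  obtain ⟨u, v, hu, huv, hv, hxu, hxv⟩ := times_rotate hi' hij' hj' h1' h2'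
  set x := P.face (P.face (P.opp d)) with hx
  have hfx : P.face x = P.opp d := face_iterate_three hD.1
  have hax : P.ahead x = a := by rw [ahead_eq_face_opp_face, hfx, P.opp_opp, ha]
  have hac : P.ahead c = P.face (P.opp d) := by rw [ahead_eq_face_opp_face, hd]
  obtain ⟨v, rfl⟩ : ∃ w, v = w + 1 := ⟨v - 1, by omega⟩
  have hxc : P.ahead^[v] x = c := by
    apply P.ahead_injective
    rw [← Function.iterate_succ_apply' P.ahead, hxv, hac]
  have hne := crossing_face_ne hP.not_reducible
  have hKd : P.crossing (P.opp d) = P.crossing a := by rw [← crossing_face, ha]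
  have h1u : 1 ≠ u := by
    intro h
    rw [← h] at hxu
    have h' : a = P.opp d := hax.symm.trans hxu
    rw [← ha, face_apply] at h'
    exact P.rot_three_ne _ h'
  have h2u : 1 + 1 ≠ u := fun h => hne a (by
    have h' : P.ahead a = P.opp d := ahead_of_time_succ_eq (x := x) (i := 1) hax hxu h
    rw [← crossing_ahead, h', hKd])
  have hvu : u ≠ v := by
    rintro rfl
    have h' : P.opp d = c := hxu.symm.trans hxc
    rw [← h', face_apply, P.opp_opp] at hd
    exact P.rot_three_ne _ hd
  have huv1 : u + 1 ≠ v := fun h => hne c (by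
    rw [hd, ← crossing_ahead_opp, ahead_of_time_succ_eq hxu hxc h])
  have hv2 : v + 1 + 1 ≠ P.tourLength x := fun h =>
    ahead_ne_face _ (ahead_of_time_succ_eq_tourLength hxv h)
  exact ⟨x, b, c, d, u, v, hb, hc, hd, ha, by omega, by omega, by omega, hax, hxu, hxc, by
    rw [hac, crossing_ahead]⟩

theorem strictMono_three {i j k : ℕ} (h1 : i < j) (h2 : j < k) : StrictMono ![i, j, k] := by
  rw [Fin.strictMono_iff_lt_succ]
  intro n
  fin_cases n
  · exact h1
  · exact h2

theorem strictMono_four {i j k l : ℕ} (h1 : i < j) (h2 : j < k) (h3 : k < l) :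
    StrictMono ![i, j, k, l] := by
  rw [Fin.strictMono_iff_lt_succ]
  intro n
  fin_cases n
  · exact h1
  · exact h2
  · exact h3

theorem iterate_ahead_mirror (x : P.Dart) {i m : ℕ} (h : i ≤ m) :
    P.mirror.ahead^[m - i] (P.opp (P.ahead^[m] x)) = P.opp (P.ahead^[i] x) := by
  rw [ahead_mirror]
  exact iterate_ahead_opp x h

theorem tourLength_mirror_opp (x : P.Dart) (m : ℕ) :
    P.mirror.tourLength (P.opp (P.ahead^[m] x)) = P.tourLength x := by
  have h : P.mirror.tourLength (P.opp (P.ahead^[m] x)) = P.tourLength (P.opp (P.ahead^[m] x)) := by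
    unfold tourLength
    rw [ahead_mirror]
    rfl
  rw [h, tourLength_opp, ← tourLength_eq (P.sameCycle_iterate x m)]

/-- Type D is invariant under reflection: the orientation of the sides around the 3-gon and the
order in which the curve passes them are both reversed. -/
theorem IsTypeD.mirror_opp {d : P.Dart} (h : P.IsTypeD d) : P.mirror.IsTypeD (P.opp d) := by
  refine ⟨(isGon_mirror_opp d).2 h.1, ?_⟩
  obtain ⟨i, j, hi, hij, hj, h1, h2⟩ := h.exists_times
  obtain ⟨k, l, hk, hkl, hl, h3, h4⟩ := times_rotate hi hij hj h1 h2
  have h5 := face_iterate_three h.1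
  generalize P.face d = e at *
  obtain ⟨n, hn⟩ : ∃ n, P.tourLength e = n + 1 := ⟨P.tourLength e - 1, by omega⟩
  refine ⟨P.opp (P.ahead^[n] e), ![n - l, n - k, n - 0], ?_, ?_, ?_⟩
  · exact strictMono_three (by omega) (by omega)
  · have hN := tourLength_mirror_opp e n
    change ∀ j, _ < P.mirror.tourLength _
    rw [hN]
    intro j
    fin_cases j
    · change n - l < P.tourLength e; omega
    · change n - k < P.tourLength e; omega
    · change n - 0 < P.tourLength e; omega
  · have hf1 : P.mirror.face (P.opp d) = P.opp (P.face e) := by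
      conv_lhs => rw [← h5]
      exact face_mirror_opp (P.face e)
    have hf2 : P.mirror.face (P.mirror.face (P.opp d)) = P.opp e := by
      rw [hf1]
      exact face_mirror_opp e
    intro j
    fin_cases j
    · exact (iterate_ahead_mirror e (by omega)).trans (congrArg P.opp h4)
    · exact (iterate_ahead_mirror e (by omega)).trans ((congrArg P.opp h3).trans hf1.symm)
    · exact (iterate_ahead_mirror e (by omega)).trans hf2.symm

namespace FourGonTimes

variable {x a b c d : P.Dart} {u v : ℕ}

theorem crossing_ahead_a (h : P.FourGonTimes x a b c d u v) :
    P.crossing (P.ahead a) = P.crossing b := by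
  rw [crossing_ahead, h.face_a]

theorem crossing_ahead_c (h : P.FourGonTimes x a b c d u v) :
    P.crossing (P.ahead c) = P.crossing d := by
  rw [crossing_ahead, h.face_c]

theorem crossing_opp_d (h : P.FourGonTimes x a b c d u v) :
    P.crossing (P.opp d) = P.crossing a := by
  rw [← crossing_face, h.face_d]

theorem crossing_opp_b (h : P.FourGonTimes x a b c d u v) :
    P.crossing (P.opp b) = P.crossing c := by
  rw [← crossing_face, h.face_b]

theorem time_a' (h : P.FourGonTimes x a b c d u v) : P.ahead^[1] x = a := h.time_a

theorem crossing_two (h : P.FourGonTimes x a b c d u v) :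
    P.crossing (P.ahead^[2] x) = P.crossing b := by
  rw [← h.crossing_ahead_a, Function.iterate_succ_apply', h.time_a']

theorem crossing_u_succ (h : P.FourGonTimes x a b c d u v) :
    P.crossing (P.ahead^[u + 1] x) = P.crossing d := by
  rw [Function.iterate_succ_apply', h.time_d, crossing_ahead_opp]

theorem crossing_v_succ (h : P.FourGonTimes x a b c d u v) :
    P.crossing (P.ahead^[v + 1] x) = P.crossing d := by
  rw [Function.iterate_succ_apply', h.time_c, h.crossing_ahead_c]

theorem crossing_v_succ_succ (h : P.FourGonTimes x a b c d u v) :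
    P.crossing (P.ahead^[v + 2] x) = P.crossing x := by
  rw [Function.iterate_succ_apply', Function.iterate_succ_apply', h.time_c, h.crossing_x]

/-- The vertices between `a` and `b` and between `b` and `c` are different from the vertices of the
3-gon. -/
theorem crossing_ne_of_time (h : P.FourGonTimes x a b c d u v) {k : ℕ} (hk : k = 2 ∨ k = v) :
    P.crossing (P.ahead^[k] x) ≠ P.crossing x ∧ P.crossing (P.ahead^[k] x) ≠ P.crossing a ∧
      P.crossing (P.ahead^[k] x) ≠ P.crossing d := by
  obtain ⟨-, -, -, -, hu, huv, hv, -, hd, hc, -⟩ := id h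
  refine ⟨fun he => ?_, fun he => ?_, fun he => ?_⟩
  · refine crossing_iterate_ne (x := x) (i := 0) (j := v + 2) (k := k) (by omega) (by omega)
      (by omega) (by omega) (by omega) (by omega) ?_ he.symm
    rw [h.crossing_v_succ_succ]
    rfl
  · refine crossing_iterate_ne (x := x) (i := 1) (j := u) (k := k) (by omega) (by omega)
      (by omega) (by omega) (by omega) (by omega) ?_ ?_
    · rw [h.time_a', hd, h.crossing_opp_d]
    · rw [h.time_a', he]
  · refine crossing_iterate_ne (x := x) (i := u + 1) (j := v + 1) (k := k) (by omega) (by omega)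
      (by omega) (by omega) (by omega) (by omega) ?_ ?_
    · rw [h.crossing_u_succ, h.crossing_v_succ]
    · rw [h.crossing_u_succ, he]

/-- The side `b` is passed in one of the three gaps between `a`, `d` and `c`. -/
theorem gaps (h : P.FourGonTimes x a b c d u v) {β : P.Dart} {w : ℕ} (hw : w < P.tourLength x)
    (hwβ : P.ahead^[w] x = β)
    (h1 : P.crossing β = P.crossing b ∨ P.crossing β = P.crossing c)
    (h2 : P.crossing (P.ahead β) = P.crossing b ∨ P.crossing (P.ahead β) = P.crossing c)
    (haβ : P.ahead a ≠ β) (hβ : β ≠ c) (hβc : P.ahead β ≠ c) :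
    (3 ≤ w ∧ w + 2 ≤ u) ∨ (u + 2 ≤ w ∧ w + 2 ≤ v) ∨ (v + 3 ≤ w ∧ w + 2 ≤ P.tourLength x) := by
  obtain ⟨-, -, -, -, hu, huv, hv, ha, hd, hc, -⟩ := id h
  have hb3 := h.crossing_ne_of_time (Or.inl rfl)
  have hc3 := h.crossing_ne_of_time (Or.inr rfl)
  rw [h.crossing_two] at hb3
  rw [hc] at hc3
  have hfree : ∀ z, P.crossing z = P.crossing b ∨ P.crossing z = P.crossing c →
      P.crossing z ≠ P.crossing x ∧ P.crossing z ≠ P.crossing a ∧ P.crossing z ≠ P.crossing d := by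
    rintro z (hz | hz) <;> rw [hz] <;> assumption
  obtain ⟨k1, k2, k3⟩ := hfree β h1
  obtain ⟨l1, l2, l3⟩ := hfree _ h2
  have hcr : P.crossing (P.ahead^[w] x) = P.crossing β := by rw [hwβ]
  have w0 : w ≠ 0 := by rintro rfl; exact k1 hcr.symm
  have w1 : w ≠ 1 := by rintro rfl; exact k2 (by rw [← hcr, h.time_a'])
  have w2 : w ≠ 2 := by
    rintro rfl
    exact haβ (by rw [← hwβ, ← ha]; rfl)
  have wu : w ≠ u := by rintro rfl; exact k2 (by rw [← hcr, hd, h.crossing_opp_d])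
  have wu1 : w ≠ u + 1 := by rintro rfl; exact k3 (by rw [← hcr, h.crossing_u_succ])
  have wv : w ≠ v := by rintro rfl; exact hβ (hwβ.symm.trans hc)
  have wv1 : w ≠ v + 1 := by rintro rfl; exact k3 (by rw [← hcr, h.crossing_v_succ])
  have wv2 : w ≠ v + 2 := by rintro rfl; exact k1 (by rw [← hcr, h.crossing_v_succ_succ])
  have wu' : w + 1 ≠ u := fun he =>
    l2 (by rw [ahead_of_time_succ_eq hwβ hd he, h.crossing_opp_d])
  have wv' : w + 1 ≠ v := fun he => hβc (ahead_of_time_succ_eq hwβ hc he)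
  have wN : w + 1 ≠ P.tourLength x := fun he =>
    l1 (by rw [ahead_of_time_succ_eq_tourLength hwβ he])
  omega

theorem stretch_start (h : P.FourGonTimes x a b c d u v) :
    P.stretch x 0 (P.tourLength x) =
      P.crossing x :: P.crossing a :: P.crossing b :: P.stretch x 3 (P.tourLength x) := by
  have := h.v_le
  rw [stretch_cons x (by omega), stretch_cons x (by omega), stretch_cons x (by omega), zero_add,
    h.time_a', h.crossing_two]
  rfl

theorem stretch_d (h : P.FourGonTimes x a b c d u v) {e : ℕ} (he : u + 2 ≤ e) :
    P.stretch x u e = P.crossing a :: P.crossing d :: P.stretch x (u + 2) e := by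
  rw [stretch_edge he h.time_d, h.crossing_opp_d, crossing_ahead_opp]

theorem stretch_c (h : P.FourGonTimes x a b c d u v) {e : ℕ} (he : v + 3 ≤ e) :
    P.stretch x v e = P.crossing c :: P.crossing d :: P.crossing x :: P.stretch x (v + 3) e := by
  rw [stretch_edge (by omega) h.time_c, h.crossing_ahead_c, stretch_cons x (by omega),
    h.crossing_v_succ_succ]

end FourGonTimes

open UnavoidableSet in
/-- In a curve of reductivity four, each 4-gon that shares a side with a 3-gon of type D has, up to
mirror image, one of the two cyclic words for which three splices at its vertices do not suffice. -/
theorem FourGonTimes.hasConfiguration (hP : P.Tangled) {x a b c d : P.Dart} {u v : ℕ}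
    (h : P.FourGonTimes x a b c d u v) (h4 : P.IsGon 4 a)
    (hD : P.IsTypeD (P.side a 3 false)) : ∃ C ∈ U3, P.HasConfiguration C := by
  obtain ⟨hab, hbc, hcd, hda, hu, huv, hv, ha, hd, hc, -⟩ := id h
  have hbc' : P.crossing c ≠ P.crossing b := hbc ▸ crossing_face_ne hP.not_reducible b
  have hs1 : ∀ s, P.side a 1 s = if s then b else P.opp b := fun s => by
    change (if s then P.face a else P.opp (P.face a)) = _
    rw [hab]
  have hs2 : P.side a 2 true = c := by
    change P.face (P.face a) = c
    rw [hab, hbc]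
  have hs3 : P.side a 3 false = P.opp d := by
    change P.opp (P.face (P.face (P.face a))) = P.opp d
    rw [hab, hbc, hcd]
  rw [hs3] at hD
  have hm1 : P.mirror.face (P.opp c) = P.opp b := hbc ▸ face_mirror_opp b
  have hm2 : P.mirror.face (P.mirror.face (P.opp c)) = P.opp a := by
    rw [hm1]
    exact hab ▸ face_mirror_opp a
  have hm3 : P.mirror.face (P.mirror.face (P.mirror.face (P.opp c))) = P.opp d := by
    rw [hm2]
    exact hda ▸ face_mirror_opp d
  have hstart := h.stretch_start
  rcases P.sameCycle_ahead_or x b with hb | hb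
  · obtain ⟨w, hwN, hw⟩ := exists_time hb
    have hcb : P.crossing (P.ahead b) = P.crossing c := by rw [crossing_ahead, hbc]
    rcases h.gaps hwN hw (Or.inl rfl) (Or.inr hcb) (hab ▸ ahead_ne_face a)
      (fun he => hbc' (by rw [he])) (hbc ▸ ahead_ne_face b) with ⟨h1, h2⟩ | ⟨h1, h2⟩ | ⟨h1, h2⟩
    · -- the word is `abdc`
      refine ⟨⟨4, oneOdd, ![0, 1, 3, 2], 3⟩, by simp [U3, withFourGon], Or.inl
        ⟨a, h4, ⟨x, ![1, w, u, v], ?_, ?_, ?_⟩, ?_⟩⟩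
      · exact strictMono_four (by omega) (by omega) (by omega)
      · change ∀ j, _ < P.tourLength x
        intro j
        fin_cases j
        · change 1 < P.tourLength x; omega
        · exact hwN
        · change u < P.tourLength x; omega
        · change v < P.tourLength x; omega
      · intro j
        fin_cases j
        · exact ha
        · exact hw.trans (hs1 true).symm
        · exact hd.trans hs3.symm
        · exact hc.trans hs2.symm
      · change P.IsTypeD (P.side a 3 false)
        rwa [hs3]
    · -- the word is `adbc`, the mirror image of `abdc`
      refine ⟨⟨4, oneOdd, ![0, 1, 3, 2], 3⟩, by simp [U3, withFourGon], Or.inr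
        ⟨P.mirror, P.isMirror_mirror, P.opp c, ?_, ?_, ?_⟩⟩
      · have hac : P.face.SameCycle a c := by
          rw [← hbc, ← hab, Equiv.Perm.sameCycle_apply_right, Equiv.Perm.sameCycle_apply_right]
        exact (isGon_mirror_opp c).2 (hac.minimalPeriod_eq.symm.trans h4)
      · obtain ⟨n, hn⟩ : ∃ n, P.tourLength x = n + 1 := ⟨P.tourLength x - 1, by omega⟩
        refine ⟨P.opp (P.ahead^[n] x), ![n - v, n - w, n - u, n - 1], ?_, ?_, ?_⟩
        · exact strictMono_four (by omega) (by omega) (by omega)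
        · have hN := tourLength_mirror_opp x n
          change ∀ j, _ < P.mirror.tourLength _
          rw [hN]
          intro j
          fin_cases j
          · change n - v < P.tourLength x; omega
          · change n - w < P.tourLength x; omega
          · change n - u < P.tourLength x; omega
          · change n - 1 < P.tourLength x; omega
        · intro j
          fin_cases j
          · exact (iterate_ahead_mirror x (by omega)).trans (congrArg P.opp hc)
          · exact (iterate_ahead_mirror x (by omega)).trans ((congrArg P.opp hw).trans hm1.symm)
          · exact (iterate_ahead_mirror x (by omega)).trans
              ((congrArg P.opp hd).trans (congrArg P.opp hm3.symm))
          · exact (iterate_ahead_mirror x (by omega)).trans ((congrArg P.opp ha).trans hm2.symm)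
      · have hside : P.mirror.side (P.opp c) 3 false = P.opp (P.opp d) := congrArg P.opp hm3
        change P.mirror.IsTypeD (P.mirror.side (P.opp c) 3 false)
        rw [hside]
        exact hD.mirror_opp
    · -- the word is `adcb`
      refine absurd ?_ (hP.not_untangles x)
      rw [hstart, stretch_append x (s := 3) (m := u) (by omega) (by omega), h.stretch_d (by omega),
        stretch_append x (s := u + 2) (m := v) (by omega) (by omega), h.stretch_c (by omega),
        stretch_append x (s := v + 3) (m := w) (by omega) (by omega), stretch_edge h2 hw, hcb]
      exact Untangles.fourGon_oneOdd_adcb _ _ _ _ _ _ _ _ _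
  · obtain ⟨w, hwN, hw⟩ := exists_time hb
    have hcb := h.crossing_opp_b
    have hcb' := crossing_ahead_opp b
    rcases h.gaps hwN hw (Or.inr hcb) (Or.inl hcb')
      (fun he => hbc' (by rw [← hcb, ← he, h.crossing_ahead_a]))
      (fun he => P.rot_ne c ((congrArg P.rot hbc.symm).trans ((P.rot_face b).trans he)))
      (fun he => hbc' (by rw [← hcb', he])) with ⟨h1, h2⟩ | ⟨h1, h2⟩ | ⟨h1, h2⟩
    · -- the word is `abdc`
      refine absurd ?_ (hP.not_untangles x)
      rw [hstart, stretch_append x (s := 3) (m := w) (by omega) (by omega),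
        stretch_edge (by omega) hw, hcb, hcb',
        stretch_append x (s := w + 2) (m := u) (by omega) (by omega), h.stretch_d (by omega),
        stretch_append x (s := u + 2) (m := v) (by omega) (by omega), h.stretch_c (by omega)]
      exact Untangles.fourGon_alternating_abdc _ _ _ _ _ _ _ _ _
    · -- the word is `adbc`
      refine absurd ?_ (hP.not_untangles x)
      rw [hstart, stretch_append x (s := 3) (m := u) (by omega) (by omega), h.stretch_d (by omega),
        stretch_append x (s := u + 2) (m := w) (by omega) (by omega),
        stretch_edge (by omega) hw, hcb, hcb',
        stretch_append x (s := w + 2) (m := v) (by omega) (by omega), h.stretch_c (by omega)]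
      exact Untangles.fourGon_alternating_adbc _ _ _ _ _ _ _ _ _
    · -- the word is `adcb`
      refine ⟨⟨4, alternating, ![0, 3, 2, 1], 3⟩, by simp [U3, withFourGon], Or.inl
        ⟨a, h4, ⟨x, ![1, u, v, w], ?_, ?_, ?_⟩, ?_⟩⟩
      · exact strictMono_four (by omega) (by omega) (by omega)
      · change ∀ j, _ < P.tourLength x
        intro j
        fin_cases j
        · change 1 < P.tourLength x; omega
        · change u < P.tourLength x; omega
        · change v < P.tourLength x; omega
        · exact hwN
      · intro j
        fin_cases j
        · exact ha
        · exact hd.trans hs3.symm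
        · exact hc.trans hs2.symm
        · exact hw.trans (hs1 false).symm
      · change P.IsTypeD (P.side a 3 false)
        rwa [hs3]

end SphericalCurve

/-! ### Discharging -/

namespace SphericalCurve

variable {P : SphericalCurve}

/-- The number of sides of the face on the left of a dart. -/
noncomputable def faceSize (P : SphericalCurve) (d : P.Dart) : ℕ :=
  Function.minimalPeriod P.face d

theorem faceSize_face (d : P.Dart) : P.faceSize (P.face d) = P.faceSize d :=
  ((Equiv.Perm.sameCycle_apply_right.2 (.refl _ _) :
    P.face.SameCycle d (P.face d)).minimalPeriod_eq).symm

theorem faceSize_iterate (d : P.Dart) (i : ℕ) : P.faceSize (P.face^[i] d) = P.faceSize d := by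
  induction i with
  | zero => rfl
  | succ i ih => rw [Function.iterate_succ_apply', faceSize_face, ih]

/-- The two neighbours of a side shared with a 3-gon of type D are passed in the direction opposite
to the one of this side. -/
theorem IsTypeD.not_sameCycle_face {d : P.Dart} (h : P.IsTypeD (P.opp d)) :
    ¬ P.aheadPerm.SameCycle d (P.face d) := by
  obtain ⟨i, j, -, -, -, -, hj⟩ := h.exists_times
  have h1 := P.sameCycle_iterate (P.opp d) j
  have h3 := ahead_eq_face_opp_face (P.face (P.face (P.opp d)))
  rw [face_iterate_three h.1, P.opp_opp] at h3
  rw [hj, ← Equiv.Perm.sameCycle_apply_right, aheadPerm_apply, h3] at h1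
  exact fun h' => P.not_sameCycle_ahead_opp d (h'.trans h1.symm)

theorem IsTypeD.not_sameCycle_of_face {d : P.Dart} (h : P.IsTypeD (P.opp (P.face d))) :
    ¬ P.aheadPerm.SameCycle d (P.face d) := by
  obtain ⟨i, j, -, -, -, hi, -⟩ := h.exists_times
  have h1 := P.sameCycle_iterate (P.opp (P.face d)) i
  rw [hi, ← ahead_eq_face_opp_face, ← aheadPerm_apply, Equiv.Perm.sameCycle_apply_right] at h1
  exact fun h' => P.not_sameCycle_ahead_opp (P.face d) (h'.symm.trans h1.symm)

theorem IsTypeD.sameCycle_face {d : P.Dart} (h : P.IsTypeD d) :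
    P.aheadPerm.SameCycle d (P.face d) := by
  obtain ⟨i, j, -, -, -, hi, -⟩ := h.exists_times
  exact hi ▸ P.sameCycle_iterate d i

/-- Among the sides of a 5-gon two consecutive ones are passed in the same direction. -/
theorem exists_sameCycle_face_of_five {d : P.Dart} (h : P.face^[5] d = d) :
    ∃ i < 5, P.aheadPerm.SameCycle (P.face^[i] d) (P.face^[i + 1] d) := by
  by_contra! hcon
  have hopp : ∀ i < 5, P.aheadPerm.SameCycle (P.face^[i] d) (P.opp (P.face^[i + 1] d)) :=
    fun i hi => (P.sameCycle_ahead_or _ _).resolve_left (hcon i hi)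
  have htwo : ∀ i, i + 1 < 5 → P.aheadPerm.SameCycle (P.face^[i] d) (P.face^[i + 2] d) := by
    intro i hi
    have := sameCycle_ahead_opp (hopp (i + 1) hi)
    rw [P.opp_opp] at this
    exact (hopp i (by omega)).trans this
  have h04 := (htwo 0 (by norm_num)).trans (htwo 2 (by norm_num))
  refine hcon 4 (by norm_num) ?_
  rw [h]
  exact h04.symm

open Classical in
/-- The charge of a dart after the discharging: each face with `n` sides has the charge `4 - n`,
equally distributed to its sides, and each 3-gon gives a third of its charge across each side. -/
noncomputable def charge (P : SphericalCurve) (d : P.Dart) : ℚ :=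
  4 / (P.faceSize d : ℚ) - 1 - (if P.faceSize d = 3 then 1 / 3 else 0) +
    (if P.faceSize (P.opp d) = 3 then 1 / 3 else 0)

/-- Euler's formula: the total charge is eight. -/
theorem sum_charge [Fintype P.Dart] : ∑ d, P.charge d = 8 := by
  classical
  have h1 : (4 : ℚ) * numCycles P.rot = Fintype.card P.Dart := by
    exact_mod_cast P.four_mul_numCycles_rot.trans Nat.card_eq_fintype_card
  have h2 : (2 : ℚ) * numCycles P.opp = Fintype.card P.Dart := by
    exact_mod_cast P.two_mul_numCycles_opp.trans Nat.card_eq_fintype_card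
  have h3 : (numCycles P.rot + numCycles P.face : ℚ) = numCycles P.opp + 2 := by
    exact_mod_cast (P.euler : numCycles P.rot + numCycles P.face = numCycles P.opp + 2)
  have h4 : ∑ d : P.Dart, 4 / (P.faceSize d : ℚ) = 4 * numCycles P.face := by
    rw [numCycles_eq_sum, Finset.mul_sum]
    exact Finset.sum_congr rfl fun d _ => by rw [mul_one_div]; rfl
  have h5 := Equiv.sum_comp P.opp fun d => if P.faceSize d = 3 then (1 / 3 : ℚ) else 0
  simp only [charge, Finset.sum_add_distrib, Finset.sum_sub_distrib, h4, h5, Finset.sum_const,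
    Finset.card_univ, nsmul_eq_mul, mul_one]
  linarith

theorem exists_sum_charge_pos (P : SphericalCurve) :
    ∃ d, 0 < ∑ i ∈ Finset.range 5, P.charge (P.face^[i] d) := by
  by_contra! hcon
  have := Fintype.ofFinite P.Dart
  have hle := Finset.sum_nonpos fun d (_ : d ∈ Finset.univ) => hcon d
  have hshift : ∀ i, ∑ d, P.charge (P.face^[i] d) = 8 := by
    intro i
    rw [← sum_charge (P := P)]
    simpa only [Equiv.Perm.coe_pow] using Equiv.sum_comp (P.face ^ i) P.charge
  rw [Finset.sum_comm] at hle
  simp only [hshift, Finset.sum_const, Finset.card_range] at hle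
  norm_num at hle

/-- Each curve of reductivity four has a 4-gon that shares a side with a 3-gon. All other faces
lose their positive charge: in particular at most three sides of a 5-gon belong to 3-gons of
type D. -/
theorem exists_fourGon (hP : P.Tangled) : ∃ d, P.IsGon 4 d ∧ P.IsGon 3 (P.opp d) := by
  by_contra! hcon
  obtain ⟨d, hd⟩ := P.exists_sum_charge_pos
  have hD : ∀ y, P.faceSize y = 3 → P.IsTypeD y := fun y hy => isTypeD_of_isGon hP hy
  have hpos : 0 < P.faceSize d := P.face.minimalPeriod_pos d
  have hn1 : P.faceSize d ≠ 1 := minimalPeriod_face_ne_one hP d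
  have hn2 : P.faceSize d ≠ 2 := minimalPeriod_face_ne_two hP d
  by_cases h5 : P.faceSize d = 5
  · have hle : ∀ y, P.faceSize y = 5 → P.charge y ≤ -1 / 5 + 1 / 3 := by
      intro y hy
      rw [charge, hy]
      split_ifs <;> norm_num
    have hle' : ∀ y, P.faceSize y = 5 → P.faceSize (P.opp y) ≠ 3 → P.charge y ≤ -1 / 5 := by
      intro y hy hy'
      rw [charge, hy, if_neg hy']
      norm_num
    have hper : P.face^[5] d = d := h5 ▸ Function.iterate_minimalPeriod
    obtain ⟨i, hi, hs⟩ := exists_sameCycle_face_of_five hper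
    have hsz := fun i => (P.faceSize_iterate d i).trans h5
    rw [Function.iterate_succ_apply'] at hs
    have hi1 : P.charge (P.face^[i] d) ≤ -1 / 5 :=
      hle' _ (hsz i) fun h => (hD _ h).not_sameCycle_face hs
    have hi2 : P.charge (P.face^[i + 1] d) ≤ -1 / 5 := by
      refine hle' _ (hsz _) fun h => ?_
      rw [Function.iterate_succ_apply'] at h
      exact (hD _ h).not_sameCycle_of_face hs
    have hall := fun i => hle _ (hsz i)
    have h0 := hall 0
    have h1 := hall 1
    have h2 := hall 2
    have h3 := hall 3
    have h4 := hall 4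
    simp only [Finset.sum_range_succ, Finset.sum_range_zero] at hd
    interval_cases i
    · linarith
    · linarith
    · linarith
    · linarith
    · rw [show 4 + 1 = 5 from rfl, hper] at hi2
      have : P.charge (P.face^[0] d) ≤ -1 / 5 := hi2
      linarith
  · refine absurd hd (not_lt.2 (Finset.sum_nonpos fun i _ => ?_))
    have hsz := P.faceSize_iterate d i
    generalize P.face^[i] d = y at hsz
    rw [← hsz] at hpos hn1 hn2 h5
    by_cases h3 : P.faceSize y = 3
    · have hopp : P.faceSize (P.opp y) ≠ 3 := fun h =>
        (hD _ h).not_sameCycle_face (hD y h3).sameCycle_face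
      rw [charge, if_neg hopp, h3]
      norm_num
    by_cases h4 : P.faceSize y = 4
    · have hopp : P.faceSize (P.opp y) ≠ 3 := hcon y h4
      rw [charge, if_neg hopp, h4]
      norm_num
    · have h6 : 6 ≤ P.faceSize y := by omega
      have h6' : (6 : ℚ) ≤ P.faceSize y := by exact_mod_cast h6
      have hle : 4 / (P.faceSize y : ℚ) ≤ 2 / 3 := by
        rw [div_le_div_iff₀ (by linarith) (by norm_num)]
        linarith
      rw [charge, if_neg h3]
      split_ifs <;> linarith

end SphericalCurve

theorem theorem2 : IsUnavoidable U3 (fun P : SphericalCurve => P.reductivity = 4) := by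
  intro P hr
  have hP := SphericalCurve.tangled_of_reductivity hr
  obtain ⟨d, h4, h3⟩ := SphericalCurve.exists_fourGon hP
  -- the side `d` of the 4-gon gets the last label
  have hside : P.side (P.face d) 3 false = P.opp d :=
    congrArg P.opp (SphericalCurve.face_iterate_four h4)
  have h4' : P.IsGon 4 (P.face d) := (SphericalCurve.faceSize_face d).trans h4
  have hD : P.IsTypeD (P.side (P.face d) 3 false) := by
    rw [hside]
    exact SphericalCurve.isTypeD_of_isGon hP h3
  obtain ⟨x, b, c, e, u, v, h⟩ := SphericalCurve.exists_fourGonTimes hP h4' hD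
  exact h.hasConfiguration hP h4' hD
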